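/- Let $n>4$ be an integer and let $D_n=\langle x,t\mid x^n=t^2=1,\ xt=tx^{-1}\rangle$ be the dihedral group of order $2n$. For a finite group $G$ let $B=\operatorname{Perm}(G)$ be the group of all permutations of the set $G$, let $\lambda(G)\le B$ be the image of the left regular representation $\lambda(g)(h)=gh$, and call a subgroup $N\le B$ regular if it acts transitively on $G$ with trivial point stabilizers. Put $$\mathcal S(G)=\{N\le B : N \text{ regular},\ N\cong G,\ N\le \operatorname{Norm}_B(\lambda(G))\},$$ $$\mathcal R(G)=\{N\le B : N \text{ regular},\ N\cong G,\ \lambda(G)\le \operatorname{Norm}_B(N)\},$$ and let $$\mathcal Q(G)=\bigcap_{N\in\mathcal S(G)\cap\mathcal R(G)}\{M\in\mathcal S(G)\cap\mathcal R(G) : N\le \operatorname{Norm}_B(M)\}.$$ In $D_n$ let $X_0=\{1,x,\dots,x^{n-1}\}$ and $Y_0=\{t,tx,\dots,tx^{n-1}\}$, and let $R(D_n,[D_n];W(X_0,Y_0))$ be the set of those $N\in\mathcal R(D_n)$ whose characteristic subgroup of index $2$ (i.e. of order $n$) has $X_0$ and $Y_0$ as its orbits on $D_n$. Let $\Upsilon_n=\{u\in(\mathbb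 Z/n\mathbb Z)^\times : u^2=1\}$. Then $$\mathcal Q(D_n)=R(D_n,[D_n];W(X_0,Y_0)),$$ and consequently $$|\mathcal Q(D_n)|=\begin{cases}|\Upsilon_n| & \text{if } 8\nmid n,\\ 2\,|\Upsilon_n| & \text{if } 8\mid n.\end{cases}$$ -/

import Mathlib

namespace QuasiHol

open Equiv

/-- A permutation group `N ≤ Perm X` is regular: it acts transitively on `X` and all point
stabilizers are trivial. -/
def IsRegularSubgroup {X : Type*} (N : Subgroup (Perm X)) : Prop :=
  MulAction.IsPretransitive N X ∧ ∀ x : X, MulAction.stabilizer N x = ⊥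

/-- `Hol(N)`: the normalizer of `N` in the full permutation group. -/
def Hol {X : Type*} (N : Subgroup (Perm X)) : Subgroup (Perm X) :=
  Subgroup.normalizer (N : Set (Perm X))

/-- `S(G_j, [G_i])`: the regular subgroups of `Hol(G_j)` that are isomorphic to `G_i`. -/
def classS {X : Type*} (Gj Gi : Subgroup (Perm X)) : Set (Subgroup (Perm X)) :=
  {M | M ≤ Hol Gj ∧ IsRegularSubgroup M ∧ Nonempty (M ≃* Gi)}

/-- `R(G_i, [G_j])`: the regular subgroups isomorphic to `G_j` that are normalized by `G_i`. -/
def classR {X : Type*} (Gi Gj : Subgroup (Perm X)) : Set (Subgroup (Perm X)) :=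
  {N | IsRegularSubgroup N ∧ Gi ≤ Hol N ∧ Nonempty (N ≃* Gj)}

/-- `λ(G)`: the image of the left regular representation `λ(g)(h) = g * h`. -/
def leftReg (G : Type*) [Group G] : Subgroup (Perm G) :=
  (MulAction.toPermHom G G).range

/-- `𝒮(G) = S(λ(G), [λ(G)])`. -/
def calS (G : Type*) [Group G] : Set (Subgroup (Perm G)) :=
  classS (leftReg G) (leftReg G)

/-- `ℛ(G) = R(λ(G), [λ(G)])`. -/
def calR (G : Type*) [Group G] : Set (Subgroup (Perm G)) :=
  classR (leftReg G) (leftReg G)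

/-- `𝒬(G)`: the intersection, over all `N ∈ 𝒮(G) ∩ ℛ(G)`, of the sets of those
`M ∈ 𝒮(G) ∩ ℛ(G)` that are normalized by `N`. -/
def calQ (G : Type*) [Group G] : Set (Subgroup (Perm G)) :=
  ⋂ N ∈ calS G ∩ calR G, {M | M ∈ calS G ∩ calR G ∧ N ≤ Hol M}

/-- The index `2` characteristic subgroup of `N` has exactly `A` and `B` as its orbits on `X`. -/
def CharBlocks {X : Type*} (N : Subgroup (Perm X)) (A B : Set X) : Prop :=
  ∃ K : Subgroup N, K.Characteristic ∧ K.index = 2 ∧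
    Set.range (fun x : X => MulAction.orbit K x) = {A, B}

/-- `R(G_i, [G_j]; W(A, B))`: the members of `R(G_i, [G_j])` whose index `2` characteristic
subgroup has block structure `{A, B}`. -/
def classRW {X : Type*} (Gi Gj : Subgroup (Perm X)) (A B : Set X) :
    Set (Subgroup (Perm X)) :=
  {N | N ∈ classR Gi Gj ∧ CharBlocks N A B}

/-- `X₀ = {1, x, …, x ^ (n - 1)}`, with `x = r 1`. -/
def X0 (n : ℕ) : Set (DihedralGroup n) := Set.range DihedralGroup.r

/-- `Y₀ = {t, t x, …, t x ^ (n - 1)}`, with `t = sr 0` and `t x ^ i = sr i`. -/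
def Y0 (n : ℕ) : Set (DihedralGroup n) := Set.range DihedralGroup.sr

/-- `Υ_n = {u ∈ U_n | u² = 1}`, where `U_n` is the unit group of `ℤ/nℤ`. -/
def Upsilon (n : ℕ) : Set (ZMod n)ˣ := {u | u ^ 2 = 1}

end QuasiHol

namespace QuasiHol

open Equiv DihedralGroup

/-! Identify each of the blocks `X0`, `Y0` with `ZMod n`. Every element of the holomorph of `λ(D_n)`
is affine on both blocks with one common multiplier `c`, and either preserves or swaps them, so all
computations take place on triples `(c, p, q)`.

The groups in `R(D_n, [D_n]; W(X₀, Y₀))` are exactly the groups `blockGroup u s` with `u² = 1` and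
`s` a twist (`exists_eq_blockGroup_of_mem_classRW`, `blockGroup_mem_classRW`). Here `1 + s` is the
multiplier by which left translation by `r 1` acts on the rotations of `N`. A twist is `0`, or `n /
2` when `8 ∣ n`; distinct pairs `(u, s)` give distinct groups, which yields the count.

Block groups lie in `𝒬`: an affine map `(c, p, q)` with `c` a unit normalizes `blockGroup u s` as
soon as `s p = s q`, and every element of a group in `𝒮 ∩ ℛ` satisfies this parity condition
(`exists_parity_of_mem_range`).

Conversely, a group in `𝒬` is normalized by both regular representations, hence by the product of
left and right translation by `r 1`, which shifts one block by `2` and fixes the other pointwise. If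
a generating rotation of the group swapped the blocks, its commutator with this shift would force `4
= 0` in `ZMod n`. So the rotations preserve the blocks, and regularity makes the blocks their
orbits. -/

variable {n : ℕ}

/-! ### Calculus of affine permutations of the two blocks -/

/-- `g` acts by `r i ↦ r (c i + p)` and `sr i ↦ sr (c i + q)`. -/
def IsPreserving (g : Perm (DihedralGroup n)) (c p q : ZMod n) : Prop :=
  ∀ i, g (r i) = r (c * i + p) ∧ g (sr i) = sr (c * i + q)

/-- `g` acts by `r i ↦ sr (c i + p)` and `sr i ↦ r (c i + q)`. -/
def IsSwapping (g : Perm (DihedralGroup n)) (c p q : ZMod n) : Prop :=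
  ∀ i, g (r i) = sr (c * i + p) ∧ g (sr i) = r (c * i + q)

theorem isPreserving_one : IsPreserving (1 : Perm (DihedralGroup n)) 1 0 0 := by
  intro i; simp

theorem IsPreserving.mul_preserving {g g' : Perm (DihedralGroup n)} {c p q c' p' q' : ZMod n}
    (h : IsPreserving g c p q) (h' : IsPreserving g' c' p' q') :
    IsPreserving (g * g') (c * c') (c * p' + p) (c * q' + q) := by
  intro i
  simp only [Perm.mul_apply, (h' i).1, (h' i).2, (h _).1, (h _).2, r.injEq, sr.injEq]
  constructor <;> ring

theorem IsPreserving.mul_swapping {g g' : Perm (DihedralGroup n)} {c p q c' p' q' : ZMod n}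
    (h : IsPreserving g c p q) (h' : IsSwapping g' c' p' q') :
    IsSwapping (g * g') (c * c') (c * p' + q) (c * q' + p) := by
  intro i
  simp only [Perm.mul_apply, (h' i).1, (h' i).2, (h _).1, (h _).2, r.injEq, sr.injEq]
  constructor <;> ring

theorem IsSwapping.mul_preserving {g g' : Perm (DihedralGroup n)} {c p q c' p' q' : ZMod n}
    (h : IsSwapping g c p q) (h' : IsPreserving g' c' p' q') :
    IsSwapping (g * g') (c * c') (c * p' + p) (c * q' + q) := by
  intro i
  simp only [Perm.mul_apply, (h' i).1, (h' i).2, (h _).1, (h _).2, r.injEq, sr.injEq]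
  constructor <;> ring

theorem IsSwapping.mul_swapping {g g' : Perm (DihedralGroup n)} {c p q c' p' q' : ZMod n}
    (h : IsSwapping g c p q) (h' : IsSwapping g' c' p' q') :
    IsPreserving (g * g') (c * c') (c * p' + q) (c * q' + p) := by
  intro i
  simp only [Perm.mul_apply, (h' i).1, (h' i).2, (h _).1, (h _).2, r.injEq, sr.injEq]
  constructor <;> ring

theorem IsPreserving.inv {g : Perm (DihedralGroup n)} {c c' p q : ZMod n}
    (h : IsPreserving g c p q) (hc : c * c' = 1) :
    IsPreserving g⁻¹ c' (-(c' * p)) (-(c' * q)) := by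
  intro i
  simp only [Perm.inv_eq_iff_eq, (h _).1, (h _).2, r.injEq, sr.injEq]
  constructor
  · linear_combination (p - i) * hc
  · linear_combination (q - i) * hc

theorem IsSwapping.inv {g : Perm (DihedralGroup n)} {c c' p q : ZMod n}
    (h : IsSwapping g c p q) (hc : c * c' = 1) :
    IsSwapping g⁻¹ c' (-(c' * q)) (-(c' * p)) := by
  intro i
  simp only [Perm.inv_eq_iff_eq, (h _).1, (h _).2, r.injEq, sr.injEq]
  constructor
  · linear_combination (q - i) * hc
  · linear_combination (p - i) * hc

theorem IsPreserving.unique {g : Perm (DihedralGroup n)} {c p q c' p' q' : ZMod n}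
    (h : IsPreserving g c p q) (h' : IsPreserving g c' p' q') : c = c' ∧ p = p' ∧ q = q' := by
  have h0 := (h 0).1.symm.trans (h' 0).1
  have h1 := (h 1).1.symm.trans (h' 1).1
  have h2 := (h 0).2.symm.trans (h' 0).2
  simp only [r.injEq, sr.injEq] at h0 h1 h2
  refine ⟨by linear_combination h1 - h0, by linear_combination h0, by linear_combination h2⟩

theorem IsPreserving.ext {g g' : Perm (DihedralGroup n)} {c p q : ZMod n}
    (h : IsPreserving g c p q) (h' : IsPreserving g' c p q) : g = g' := by
  ext (i | i)
  · rw [(h i).1, (h' i).1]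
  · rw [(h i).2, (h' i).2]

theorem IsSwapping.ext {g g' : Perm (DihedralGroup n)} {c p q : ZMod n}
    (h : IsSwapping g c p q) (h' : IsSwapping g' c p q) : g = g' := by
  ext (i | i)
  · rw [(h i).1, (h' i).1]
  · rw [(h i).2, (h' i).2]

theorem IsSwapping.not_preserving {g : Perm (DihedralGroup n)} {c p q c' p' q' : ZMod n}
    (h : IsSwapping g c p q) (h' : IsPreserving g c' p' q') : False := by
  have := (h 0).1.symm.trans (h' 0).1
  simp at this

theorem exists_isPreserving {c c' : ZMod n} (hc : c * c' = 1) (p q : ZMod n) :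
    ∃ g : Perm (DihedralGroup n), IsPreserving g c p q := by
  refine ⟨⟨fun x => match x with
      | r i => r (c * i + p)
      | sr i => sr (c * i + q), fun x => match x with
      | r i => r (c' * (i - p))
      | sr i => sr (c' * (i - q)), ?_, ?_⟩, fun i => ⟨rfl, rfl⟩⟩
  · rintro (i | i) <;> simp only [r.injEq, sr.injEq] <;> linear_combination i * hc
  · rintro (i | i) <;> simp only [r.injEq, sr.injEq]
    · linear_combination (i - p) * hc
    · linear_combination (i - q) * hc

/-- Left multiplication by a rotation. -/
theorem isPreserving_left_r (a : ZMod n) :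
    IsPreserving (MulAction.toPermHom (DihedralGroup n) (DihedralGroup n) (r a)) 1 a (-a) := by
  intro i
  simp only [MulAction.toPermHom_apply, MulAction.toPerm_apply, smul_eq_mul, r_mul_r, r_mul_sr,
    r.injEq, sr.injEq]
  constructor <;> ring

/-- Left multiplication by a reflection. -/
theorem isSwapping_left_sr (a : ZMod n) :
    IsSwapping (MulAction.toPermHom (DihedralGroup n) (DihedralGroup n) (sr a)) 1 a (-a) := by
  intro i
  simp only [MulAction.toPermHom_apply, MulAction.toPerm_apply, smul_eq_mul, sr_mul_r, sr_mul_sr,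
    r.injEq, sr.injEq]
  constructor <;> ring

/-! ### Twists and block groups -/

/-- The deviation `s` of the multiplier `1 + s` by which a generator of a cyclic block group
may act on its orbits. -/
structure IsTwist (s : ZMod n) : Prop where
  add_self : s + s = 0
  mul_self : s * s = 0
  exists_mul_eq_two : ∃ e, (2 + s) * e = 2

theorem isTwist_zero : IsTwist (0 : ZMod n) := ⟨by simp, by simp, 1, by simp⟩

/-- `m * m - m` is even, and `s` annihilates even elements: `s` only sees parity. -/
theorem mul_sq_of_add_self [NeZero n] {s : ZMod n} (hs : s + s = 0) (m : ZMod n) :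
    s * (m * m) = s * m := by
  have h2 : (2 : ZMod n) ∣ m * m - m := by
    obtain ⟨k, rfl⟩ : ∃ k : ℤ, (k : ZMod n) = m := ZMod.intCast_surjective m
    obtain ⟨l, hl⟩ := Int.even_mul_pred_self k
    refine ⟨(l : ZMod n), ?_⟩
    have := congrArg (Int.cast : ℤ → ZMod n) hl
    push_cast at this
    linear_combination this
  obtain ⟨l, hl⟩ := h2
  linear_combination s * hl + l * hs

theorem mul_unit_of_add_self [NeZero n] {s c c' : ZMod n} (hs : s + s = 0) (hc : c * c' = 1) :
    s * c = s := by
  have := mul_sq_of_add_self hs c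
  linear_combination c' * this + (s - s * c) * hc

/-- The regular dihedral group with blocks `X0`, `Y0` attached to `u` and the twist `s`. -/
def blockGroup [NeZero n] (u s : ZMod n) (hu : u * u = 1) (hs : IsTwist s) :
    Subgroup (Perm (DihedralGroup n)) where
  -- The first kind are the powers of its member with `m = 1`; the second kind are their products
  -- with the involution of multiplier `-u + s` exchanging `r 0` and `sr 0`.
  carrier := {g | (∃ m, IsPreserving g (1 + s * m) m (u * m)) ∨
    ∃ m, IsSwapping g (-u + s * (m + 1)) (u * m) m}
  one_mem' := Or.inl ⟨0, by simpa using isPreserving_one⟩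
  mul_mem' := by
    have h1 := hs.add_self
    have h2 := hs.mul_self
    have h3 := mul_unit_of_add_self h1 hu
    rintro a b (⟨m, ha⟩ | ⟨m, ha⟩) (⟨k, hb⟩ | ⟨k, hb⟩)
    · refine Or.inl ⟨(1 + s * m) * k + m, ?_⟩
      convert ha.mul_preserving hb using 1 <;> grind
    · refine Or.inr ⟨(1 + s * m) * k + m, ?_⟩
      convert ha.mul_swapping hb using 1 <;> grind
    · refine Or.inr ⟨(-u + s * (m + 1)) * (u * k) + m, ?_⟩
      convert ha.mul_preserving hb using 1 <;> grind
    · refine Or.inl ⟨(-u + s * (m + 1)) * (u * k) + m, ?_⟩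
      convert ha.mul_swapping hb using 1 <;> grind
  inv_mem' := by
    have h1 := hs.add_self
    have h2 := hs.mul_self
    have h3 := mul_unit_of_add_self h1 hu
    rintro a (⟨m, ha⟩ | ⟨m, ha⟩)
    · have h4 := mul_sq_of_add_self h1 m
      refine Or.inl ⟨-((1 + s * m) * m), ?_⟩
      convert ha.inv (c' := 1 + s * m) (by grind) using 1 <;> grind
    · have h4 := mul_sq_of_add_self h1 m
      refine Or.inr ⟨-((-u + s * (m + 1)) * (u * m)), ?_⟩
      convert ha.inv (c' := -u + s * (m + 1)) (by grind) using 1 <;> grind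

/-! ### Criteria for regularity and normalization -/

theorem isRegularSubgroup_iff {X : Type*} {N : Subgroup (Perm X)} :
    IsRegularSubgroup N ↔
      (∀ x y, ∃ g ∈ N, g x = y) ∧ ∀ g ∈ N, ∀ x, g x = x → g = 1 := by
  constructor
  · rintro ⟨h, h'⟩
    refine ⟨fun x y => ?_, fun g hg x hx => ?_⟩
    · obtain ⟨g, hg⟩ := h.exists_smul_eq x y
      exact ⟨g, g.2, hg⟩
    · have : (⟨g, hg⟩ : N) ∈ MulAction.stabilizer N x := hx
      rw [h' x, Subgroup.mem_bot] at this
      exact congrArg Subtype.val this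
  · rintro ⟨h, h'⟩
    refine ⟨⟨fun x y => ?_⟩, fun x => ?_⟩
    · obtain ⟨g, hg, hxy⟩ := h x y
      exact ⟨⟨g, hg⟩, hxy⟩
    · rw [eq_bot_iff]
      intro g hg
      exact Subtype.ext (h' g g.2 x hg)

theorem IsRegularSubgroup.eq_of_apply_eq {X : Type*} {N : Subgroup (Perm X)}
    (hN : IsRegularSubgroup N) {g g' : Perm X} (hg : g ∈ N) (hg' : g' ∈ N) {x : X}
    (h : g x = g' x) : g = g' := by
  rw [isRegularSubgroup_iff] at hN
  have := hN.2 (g'⁻¹ * g) (N.mul_mem (N.inv_mem hg') hg) x (by simp [h])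
  exact (inv_mul_eq_one.mp this).symm

theorem IsRegularSubgroup.eq_of_le {X : Type*} [Nonempty X] {M N : Subgroup (Perm X)}
    (hM : IsRegularSubgroup M) (hN : IsRegularSubgroup N) (h : M ≤ N) : M = N := by
  refine le_antisymm h fun g hg => ?_
  obtain ⟨x⟩ := ‹Nonempty X›
  obtain ⟨k, hk, hkx⟩ := (isRegularSubgroup_iff.mp hM).1 x (g x)
  rwa [hN.eq_of_apply_eq hg (h hk) hkx.symm]

theorem mem_hol_iff {X : Type*} {N : Subgroup (Perm X)} {g : Perm X} :
    g ∈ Hol N ↔ ∀ h, h ∈ N ↔ g * h * g⁻¹ ∈ N :=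
  Subgroup.mem_normalizer_iff

theorem mem_hol_of_forall {X : Type*} {N : Subgroup (Perm X)} {g : Perm X}
    (h : ∀ a ∈ N, g * a * g⁻¹ ∈ N) (h' : ∀ a ∈ N, g⁻¹ * a * g ∈ N) : g ∈ Hol N :=
  mem_hol_iff.mpr fun a => ⟨h a, fun ha => by simpa [mul_assoc] using h' _ ha⟩

theorem left_sr_zero_mul_self :
    MulAction.toPermHom (DihedralGroup n) (DihedralGroup n) (sr 0) *
      MulAction.toPermHom (DihedralGroup n) (DihedralGroup n) (sr 0) = 1 := by
  rw [← map_mul, sr_mul_self, map_one]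

/-! ### Regularity and normalizer of a block group -/

section blockGroup

variable [NeZero n] {u s : ZMod n} {hu : u * u = 1} {hs : IsTwist s}

theorem exists_preserving_mem (hu : u * u = 1) (hs : IsTwist s) (m : ZMod n) :
    ∃ g ∈ blockGroup u s hu hs, IsPreserving g (1 + s * m) m (u * m) := by
  have h1 := hs.add_self
  have h2 := hs.mul_self
  obtain ⟨g, hg⟩ := exists_isPreserving (c := 1 + s * m) (c' := 1 + s * m) (by grind) m (u * m)
  exact ⟨g, Or.inl ⟨m, hg⟩, hg⟩

theorem exists_swapping_mem (hu : u * u = 1) (hs : IsTwist s) (m : ZMod n) :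
    ∃ g ∈ blockGroup u s hu hs, IsSwapping g (-u + s * (m + 1)) (u * m) m := by
  have h1 := hs.add_self
  have h2 := hs.mul_self
  have h3 := mul_unit_of_add_self h1 hu
  obtain ⟨g, hg⟩ := exists_isPreserving (c := -u + s * (m + 1)) (c' := -u + s * (m + 1))
    (by grind) (u * m) m
  have := (isSwapping_left_sr (0 : ZMod n)).mul_preserving hg
  simp only [one_mul, add_zero, neg_zero] at this
  exact ⟨_, Or.inr ⟨m, this⟩, this⟩

theorem isRegularSubgroup_blockGroup : IsRegularSubgroup (blockGroup u s hu hs) := by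
  have h1 := hs.add_self
  have h2 := hs.mul_self
  have h3 := mul_unit_of_add_self h1 hu
  have key : ∀ y, ∃ g ∈ blockGroup u s hu hs, g (r 0) = y := by
    rintro (m | m)
    · obtain ⟨g, hg, hg'⟩ := exists_preserving_mem hu hs m
      exact ⟨g, hg, by rw [(hg' 0).1]; simp⟩
    · obtain ⟨g, hg, hg'⟩ := exists_swapping_mem hu hs (u * m)
      exact ⟨g, hg, by rw [(hg' 0).1, sr.injEq]; linear_combination m * hu⟩
  rw [isRegularSubgroup_iff]
  refine ⟨fun x y => ?_, ?_⟩
  · obtain ⟨g, hg, rfl⟩ := key x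
    obtain ⟨g', hg', rfl⟩ := key y
    exact ⟨g' * g⁻¹, mul_mem hg' (inv_mem hg), by simp⟩
  · rintro g (⟨m, hg⟩ | ⟨m, hg⟩) (i | i) hx
    · rw [(hg i).1, r.injEq] at hx
      obtain rfl : m = 0 := by grind
      refine IsPreserving.ext hg ?_
      simpa using isPreserving_one
    · rw [(hg i).2, sr.injEq] at hx
      obtain rfl : m = 0 := by grind
      refine IsPreserving.ext hg ?_
      simpa using isPreserving_one
    · rw [(hg i).1] at hx; simp at hx
    · rw [(hg i).2] at hx; simp at hx

/-- Conjugation turns the translations `m`, `u m` into `c m - s p m`, `c u m - s q m`. The second is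
still `u` times the first because `s p = s q` and `s u = s`. -/
theorem IsPreserving.conj_mem_blockGroup {g : Perm (DihedralGroup n)} {c c' p q : ZMod n}
    (hg : IsPreserving g c p q) (hc : c * c' = 1) (hpq : s * p = s * q)
    {a : Perm (DihedralGroup n)} (ha : a ∈ blockGroup u s hu hs) :
    g * a * g⁻¹ ∈ blockGroup u s hu hs := by
  have h1 := hs.add_self
  have h2 := hs.mul_self
  have h3 := mul_unit_of_add_self h1 hu
  have h4 := mul_unit_of_add_self h1 hc
  have h5 := mul_sq_of_add_self h1 p
  have h6 := mul_sq_of_add_self h1 q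
  suffices h : ∃ b ∈ blockGroup u s hu hs, g * a = b * g by
    obtain ⟨b, hb, h⟩ := h
    rwa [h, mul_inv_cancel_right]
  obtain ⟨m, ha⟩ | ⟨m, ha⟩ := ha
  · obtain ⟨b, hb, hb'⟩ := exists_preserving_mem hu hs (c * m - s * p * m)
    refine ⟨b, hb, (hg.mul_preserving ha).ext ?_⟩
    convert hb'.mul_preserving hg using 1 <;> grind
  -- The parameter solves the second translation component of `g * a = b * g`.
  · obtain ⟨b, hb, hb'⟩ := exists_swapping_mem hu hs (c * m + p + u * q + s * (m + 1) * q)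
    refine ⟨b, hb, (hg.mul_swapping ha).ext ?_⟩
    convert hb'.mul_preserving hg using 1 <;> grind

theorem IsPreserving.mem_hol_blockGroup {g : Perm (DihedralGroup n)} {c c' p q : ZMod n}
    (hg : IsPreserving g c p q) (hc : c * c' = 1) (hpq : s * p = s * q) :
    g ∈ Hol (blockGroup u s hu hs) := by
  refine mem_hol_of_forall (fun a ha => hg.conj_mem_blockGroup hc hpq ha) fun a ha => ?_
  have := (hg.inv hc).conj_mem_blockGroup (c' := c) (by rw [mul_comm, hc])
    (by linear_combination -c' * hpq) ha
  rwa [inv_inv] at this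

theorem left_sr_zero_mem_hol_blockGroup :
    MulAction.toPermHom (DihedralGroup n) (DihedralGroup n) (sr 0) ∈
      Hol (blockGroup u s hu hs) := by
  have h1 := hs.add_self
  have h3 := mul_unit_of_add_self h1 hu
  have ht := isSwapping_left_sr (0 : ZMod n)
  have hinv := inv_eq_of_mul_eq_one_left (left_sr_zero_mul_self (n := n))
  have key : ∀ a ∈ blockGroup u s hu hs, MulAction.toPermHom (DihedralGroup n) (DihedralGroup n) (sr 0) * a *
      MulAction.toPermHom (DihedralGroup n) (DihedralGroup n) (sr 0) ∈ blockGroup u s hu hs := by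
    rintro a (⟨m, ha⟩ | ⟨m, ha⟩)
    · refine Or.inl ⟨u * m, ?_⟩
      convert (ht.mul_preserving ha).mul_swapping ht using 1 <;> grind
    · refine Or.inr ⟨u * m, ?_⟩
      convert (ht.mul_swapping ha).mul_swapping ht using 1 <;> grind
  refine mem_hol_of_forall ?_ ?_ <;> rw [hinv] <;> exact key

theorem IsSwapping.mem_hol_blockGroup {g : Perm (DihedralGroup n)} {c c' p q : ZMod n}
    (hg : IsSwapping g c p q) (hc : c * c' = 1) (hpq : s * p = s * q) :
    g ∈ Hol (blockGroup u s hu hs) := by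
  have ht := isSwapping_left_sr (0 : ZMod n)
  have h := ht.mul_swapping hg
  have : g = MulAction.toPermHom (DihedralGroup n) (DihedralGroup n) (sr 0) *
      (MulAction.toPermHom (DihedralGroup n) (DihedralGroup n) (sr 0) * g) := by
    rw [← mul_assoc, left_sr_zero_mul_self, one_mul]
  rw [this]
  refine mul_mem left_sr_zero_mem_hol_blockGroup (h.mem_hol_blockGroup (c' := c') ?_ ?_)
  · linear_combination hc
  · linear_combination hpq

theorem leftReg_le_hol_blockGroup :
    leftReg (DihedralGroup n) ≤ Hol (blockGroup u s hu hs) := by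
  have h1 := hs.add_self
  rintro _ ⟨a | a, rfl⟩
  · exact (isPreserving_left_r a).mem_hol_blockGroup (one_mul 1) (by linear_combination a * h1)
  · exact (isSwapping_left_sr a).mem_hol_blockGroup (one_mul 1) (by linear_combination a * h1)

end blockGroup

theorem leftReg_eq_blockGroup [NeZero n] :
    leftReg (DihedralGroup n) = blockGroup (-1) 0 (by ring) isTwist_zero := by
  apply le_antisymm
  · rintro _ ⟨a | a, rfl⟩
    · refine Or.inl ⟨a, ?_⟩
      convert isPreserving_left_r a using 1 <;> ring
    · refine Or.inr ⟨-a, ?_⟩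
      convert isSwapping_left_sr a using 1 <;> ring
  · rintro g (⟨m, hg⟩ | ⟨m, hg⟩)
    · refine ⟨r m, (isPreserving_left_r m).ext ?_⟩
      convert hg using 1 <;> ring
    · refine ⟨sr (-m), (isSwapping_left_sr (-m)).ext ?_⟩
      convert hg using 1 <;> ring

/-! ### Rotations of an abstract dihedral group and their orbits -/

theorem exists_hom_range_eq {N : Subgroup (Perm (DihedralGroup n))}
    (h : Nonempty (N ≃* leftReg (DihedralGroup n))) :
    ∃ f : DihedralGroup n →* Perm (DihedralGroup n), Function.Injective f ∧ f.range = N := by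
  obtain ⟨e⟩ := h
  have hinj : Function.Injective (MulAction.toPermHom (DihedralGroup n) (DihedralGroup n)) :=
    MulAction.toPerm_injective
  let e' : DihedralGroup n ≃* N := (MonoidHom.ofInjective hinj).trans e.symm
  refine ⟨N.subtype.comp e'.toMonoidHom, N.subtype_injective.comp e'.injective, ?_⟩
  rw [MonoidHom.range_comp, MonoidHom.range_eq_top.mpr e'.surjective, ← MonoidHom.range_eq_map,
    N.range_subtype]

theorem nonempty_mulEquiv_leftReg {f : DihedralGroup n →* Perm (DihedralGroup n)}
    (hf : Function.Injective f) : Nonempty (f.range ≃* leftReg (DihedralGroup n)) := by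
  have hinj : Function.Injective (MulAction.toPermHom (DihedralGroup n) (DihedralGroup n)) :=
    MulAction.toPerm_injective
  exact ⟨(MonoidHom.ofInjective hf).symm.trans (MonoidHom.ofInjective hinj)⟩

theorem two_ne_zero_of_two_lt (hn : 2 < n) : (2 : ZMod n) ≠ 0 := by
  intro h
  have : n ∣ 2 := (ZMod.natCast_eq_zero_iff 2 n).mp (by exact_mod_cast h)
  exact absurd (Nat.le_of_dvd (by norm_num) this) (by omega)

theorem four_ne_zero_of_four_lt (hn : 4 < n) : (4 : ZMod n) ≠ 0 := by
  intro h
  have : n ∣ 4 := (ZMod.natCast_eq_zero_iff 4 n).mp (by exact_mod_cast h)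
  exact absurd (Nat.le_of_dvd (by norm_num) this) (by omega)

theorem r_eq_r_one_pow_val [NeZero n] (i : ZMod n) : r i = (r 1 : DihedralGroup n) ^ i.val := by
  rw [r_one_pow, ZMod.natCast_zmod_val]

/-- A monomorphism of a dihedral group into a group in which the image of the first rotation
is the image of a dihedral group element maps rotations to rotations. -/
theorem exists_rotation_multiplier [NeZero n] (hn : 2 < n) {H : Type*} [Group H]
    {f φ : DihedralGroup n →* H} (hφ : Function.Injective φ)
    (h : φ (r 1) ∈ f.range) : ∃ a : ZMod n, ∀ i, φ (r i) = f (r (a * i)) := by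
  obtain ⟨a | a, ha⟩ := h
  · refine ⟨a, fun i => ?_⟩
    rw [r_eq_r_one_pow_val, map_pow, ← ha, ← map_pow, r_pow, ZMod.natCast_zmod_val]
  · exfalso
    have : φ (r 1 * r 1) = φ 1 := by
      rw [map_mul, ← ha, ← map_mul, sr_mul_self, map_one, map_one]
    have := hφ this
    rw [r_mul_r, DihedralGroup.one_def, r.injEq, one_add_one_eq_two] at this
    exact two_ne_zero_of_two_lt hn this

theorem exists_conj_rotation [NeZero n] (hn : 2 < n) {X : Type*} {f : DihedralGroup n →* Perm X}
    (hf : Function.Injective f) {g : Perm X} (hg : g ∈ Hol f.range) :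
    ∃ a : ZMod n, ∀ i, g * f (r i) = f (r (a * i)) * g := by
  obtain ⟨a, ha⟩ := exists_rotation_multiplier hn (f := f)
    (φ := (MulAut.conj g).toMonoidHom.comp f) ((MulAut.conj g).injective.comp hf)
    ((mem_hol_iff.mp hg _).mp ⟨r 1, rfl⟩)
  exact ⟨a, fun i => by simp [← ha i]⟩

/-- The rotations of a dihedral group. -/
def rotations (n : ℕ) : Subgroup (DihedralGroup n) where
  carrier := Set.range r
  one_mem' := ⟨0, rfl⟩
  mul_mem' := by rintro _ _ ⟨i, rfl⟩ ⟨j, rfl⟩; exact ⟨i + j, rfl⟩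
  inv_mem' := by rintro _ ⟨i, rfl⟩; exact ⟨-i, rfl⟩

theorem characteristic_rotations [NeZero n] (hn : 2 < n) : (rotations n).Characteristic := by
  rw [Subgroup.characteristic_iff_le_comap]
  rintro φ _ ⟨i, rfl⟩
  obtain ⟨a, ha⟩ := exists_rotation_multiplier hn (f := MonoidHom.id _) (φ := φ.toMonoidHom)
    φ.injective ⟨_, rfl⟩
  exact ⟨a * i, (ha i).symm⟩

theorem index_rotations : (rotations n).index = 2 := by
  rw [Subgroup.index_eq_two_iff]
  refine ⟨sr 0, ?_⟩
  rintro (i | i)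
  · exact Or.inr ⟨⟨i, rfl⟩, by rintro ⟨j, hj⟩; simp at hj⟩
  · exact Or.inl ⟨⟨0 - i, rfl⟩, by rintro ⟨j, hj⟩; simp at hj⟩

/-- The automorphism fixing the rotations and shifting the reflections. -/
def shiftReflections (n : ℕ) : DihedralGroup n ≃* DihedralGroup n where
  toFun x := match x with
    | r i => r i
    | sr i => sr (i + 1)
  invFun x := match x with
    | r i => r i
    | sr i => sr (i - 1)
  left_inv := by rintro (i | i) <;> simp
  right_inv := by rintro (i | i) <;> simp
  map_mul' := by
    rintro (i | i) (j | j) <;> simp <;> ring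

/-- If `L` contained a reflection, it would contain the shifted one too, hence their product `r 1`,
hence everything. Without reflections, index `2` forces every rotation into `L`. -/
theorem eq_rotations_of_characteristic [NeZero n] {L : Subgroup (DihedralGroup n)}
    (hL : L.Characteristic) (h2 : L.index = 2) : L = rotations n := by
  have hsr : ∀ i, sr i ∉ L := by
    have hshift : ∀ i, sr i ∈ L → sr (i + 1) ∈ L := fun i hi =>
      (Subgroup.characteristic_iff_le_comap.mp hL (shiftReflections n)) hi
    intro i hi
    have hr1 : r 1 ∈ L := by
      have := L.mul_mem hi (hshift i hi)
      rwa [sr_mul_sr, add_sub_cancel_left] at this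
    have hr : ∀ j, r j ∈ L := fun j => by
      rw [r_eq_r_one_pow_val]; exact L.pow_mem hr1 _
    have : L = ⊤ := by
      rw [eq_top_iff]
      rintro (j | j) -
      · exact hr j
      · have := L.mul_mem hi (hr (j - i))
        rwa [sr_mul_r, add_sub_cancel] at this
    rw [this, Subgroup.index_top] at h2
    norm_num at h2
  ext (i | i)
  · refine ⟨fun _ => ⟨i, rfl⟩, fun _ => ?_⟩
    by_contra hi
    have := (Subgroup.mul_mem_iff_of_index_two h2 (a := r i) (b := sr 0)).mpr
      (iff_of_false hi (hsr 0))
    rw [r_mul_sr] at this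
    exact hsr _ this
  · exact iff_of_false (hsr i) (by rintro ⟨j, hj⟩; simp at hj)

theorem charBlocks_iff [NeZero n] (hn : 2 < n) {X : Type*} {f : DihedralGroup n →* Perm X}
    (hf : Function.Injective f) {A B : Set X} :
    CharBlocks f.range A B ↔
      Set.range (fun x : X => Set.range fun i => f (r i) x) = {A, B} := by
  let e := MonoidHom.ofInjective hf
  have horbit : ∀ K : Subgroup f.range, K.comap e.toMonoidHom = rotations n →
      ∀ x : X, MulAction.orbit K x = Set.range fun i => f (r i) x := by
    intro K hK x
    ext y
    constructor
    · rintro ⟨⟨⟨_, ⟨z, rfl⟩⟩, hk⟩, rfl⟩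
      have : z ∈ K.comap e.toMonoidHom := hk
      rw [hK] at this
      obtain ⟨i, rfl⟩ := this
      exact ⟨i, rfl⟩
    · rintro ⟨i, rfl⟩
      have : r i ∈ K.comap e.toMonoidHom := by rw [hK]; exact ⟨i, rfl⟩
      exact ⟨⟨e (r i), this⟩, rfl⟩
  have hchar : ∀ K : Subgroup f.range,
      (K.comap e.toMonoidHom).Characteristic ↔ K.Characteristic := by
    intro K
    rw [Subgroup.characteristic_iff_le_comap, Subgroup.characteristic_iff_le_comap]
    constructor
    · intro h φ x hx
      have := @h ((e.trans φ).trans e.symm) (e.symm x) (by simpa using hx)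
      simpa using this
    · intro h φ x hx
      have := @h ((e.symm.trans φ).trans e) (e x) hx
      simpa using this
  constructor
  · rintro ⟨K, hK, h2, h⟩
    have : K.comap e.toMonoidHom = rotations n :=
      eq_rotations_of_characteristic ((hchar K).mpr hK)
        ((K.index_comap_of_surjective e.surjective).trans h2)
    simpa only [horbit K this] using h
  · intro h
    have hK : ((rotations n).map e.toMonoidHom).comap e.toMonoidHom = rotations n :=
      Subgroup.comap_map_eq_self_of_injective e.injective _
    refine ⟨(rotations n).map e.toMonoidHom, (hchar _).mp ?_, ?_, ?_⟩
    · rw [hK]; exact characteristic_rotations hn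
    · rw [← Subgroup.index_comap_of_surjective _ e.surjective]
      exact (congrArg Subgroup.index hK).trans index_rotations
    · simpa only [horbit _ hK] using h

/-! ### Affine form of the holomorph of `λ(D_n)` -/

theorem exists_of_mem_hol_leftReg [NeZero n] (hn : 2 < n) {g : Perm (DihedralGroup n)}
    (hg : g ∈ Hol (leftReg (DihedralGroup n))) :
    ∃ c c' p q, c * c' = 1 ∧ (IsPreserving g c p q ∨ IsSwapping g c p q) := by
  set l := MulAction.toPermHom (DihedralGroup n) (DihedralGroup n) with hl
  have hinj : Function.Injective l := MulAction.toPerm_injective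
  have happ : ∀ x y, l x y = x * y := fun _ _ => rfl
  obtain ⟨a, ha⟩ := exists_conj_rotation hn hinj hg
  obtain ⟨b, hb⟩ := exists_conj_rotation hn hinj (inv_mem hg)
  have hab : a * b = 1 := by
    have h1 : l (r 1) * g = l (r (a * (b * 1))) * g := by
      rw [← ha, ← mul_inv_eq_iff_eq_mul.mpr (hb 1)]
      group
    have := hinj (mul_right_cancel h1)
    rw [r.injEq] at this
    rw [this, mul_one]
  have hr : ∀ i, g (r i) = r (a * i) * g (r 0) := fun i => by
    have := congrArg (· (r 0)) (ha i)
    simpa [happ] using this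
  have hsr : ∀ i, g (sr i) = r (a * (-i)) * g (sr 0) := fun i => by
    have := congrArg (· (sr 0)) (ha (-i))
    simpa [happ] using this
  rcases hp : g (r 0) with p | p <;> rcases hq : g (sr 0) with q | q
  · exfalso
    obtain ⟨x | x, hx⟩ := g.surjective (sr 0)
    · rw [hr, hp] at hx; cases hx
    · rw [hsr, hq] at hx; cases hx
  · refine ⟨a, b, p, q, hab, Or.inl fun i => ⟨?_, ?_⟩⟩
    · rw [hr, hp, r_mul_r]
    · rw [hsr, hq, r_mul_sr, sr.injEq]; ring
  -- The sign appears because left translation by a rotation shifts the two blocks in opposite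
  -- directions.
  · refine ⟨-a, -b, p, q, by rw [neg_mul_neg, hab], Or.inr fun i => ⟨?_, ?_⟩⟩
    · rw [hr, hp, r_mul_sr, sr.injEq]; ring
    · rw [hsr, hq, r_mul_r, r.injEq]; ring
  · exfalso
    obtain ⟨x | x, hx⟩ := g.surjective (r 0)
    · rw [hr, hp] at hx; cases hx
    · rw [hsr, hq] at hx; cases hx

/-! ### Block groups are dihedral with the prescribed blocks -/

/-- The homomorphism from a dihedral group given by the images of the generators. -/
theorem exists_dihedral_hom {H : Type*} [Group H] {k y : H} (hk : k ^ n = 1)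
    (hy : y * y = 1) (hyk : y * k * y⁻¹ = k⁻¹) :
    ∃ f : DihedralGroup n →* H, (∀ i : ℤ, f (r i) = k ^ i) ∧ ∀ i : ℤ, f (sr i) = y * k ^ i := by
  let E : ZMod n →+ Additive H := ZMod.lift n ⟨zmultiplesHom _ (Additive.ofMul k), by
    rw [zmultiplesHom_apply, ← ofMul_zpow, zpow_natCast, hk, ofMul_one]⟩
  let κ : ZMod n → H := fun i => (E i).toMul
  have hκ : ∀ i : ℤ, κ i = k ^ i := fun i => by
    simp [κ, E]
  have hadd : ∀ i j, κ (i + j) = κ i * κ j := fun i j => by simp [κ]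
  have hconj : ∀ i, κ i * y = y * κ (-i) := by
    intro i
    obtain ⟨i, rfl⟩ := ZMod.intCast_surjective i
    rw [← Int.cast_neg, hκ, hκ, zpow_neg, ← inv_zpow, ← hyk, conj_zpow]
    simp only [← mul_assoc, hy, one_mul]
    rw [inv_eq_of_mul_eq_one_left hy]
  refine ⟨MonoidHom.mk' (fun x => match x with
    | r i => κ i
    | sr i => y * κ i) ?_, fun i => hκ i, fun i => congrArg (y * ·) (hκ i)⟩
  rintro (i | i) (j | j)
  · exact hadd i j
  · change y * κ (j - i) = κ i * (y * κ j)
    rw [← mul_assoc, hconj, mul_assoc, ← hadd, neg_add_eq_sub]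
  · change y * κ (i + j) = y * κ i * κ j
    rw [hadd, mul_assoc]
  · change κ (j - i) = y * κ i * (y * κ j)
    rw [mul_assoc, ← mul_assoc (κ i), hconj, mul_assoc, ← mul_assoc y y, hy, one_mul, ← hadd,
      neg_add_eq_sub]

theorem IsPreserving.exists_pow_of_isTwist {s p q : ZMod n} (hs : IsTwist s)
    {g : Perm (DihedralGroup n)} (hg : IsPreserving g (1 + s) p q) (j : ℕ) :
    ∃ m, IsPreserving (g ^ j) (1 + s * m) (p * m) (q * m) := by
  have h1 := hs.add_self
  have h2 := hs.mul_self
  induction j with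
  | zero => exact ⟨0, by simpa using isPreserving_one⟩
  | succ j ih =>
    obtain ⟨m, hm⟩ := ih
    refine ⟨m + 1 + s * m, ?_⟩
    rw [pow_succ']
    convert hg.mul_preserving hm using 1 <;> grind

/-- The square of `g` translates `X0` by `2 + s`, and `2` is a multiple of `2 + s`; so even powers
realize all even translations, and one further factor `g` reaches the odd elements. -/
theorem IsPreserving.exists_pow_apply_eq [NeZero n] {s q : ZMod n} (hs : IsTwist s)
    {g : Perm (DihedralGroup n)} (hg : IsPreserving g (1 + s) 1 q) (m : ZMod n) :
    ∃ j : ℕ, (g ^ j) (r 0) = r m := by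
  have h1 := hs.add_self
  have h2 := hs.mul_self
  obtain ⟨e, he⟩ := hs.exists_mul_eq_two
  have hsq : ∀ i, (g ^ 2) (r i) = r (i + (2 + s)) := fun i => by
    rw [pow_two, Perm.mul_apply, (hg _).1, (hg _).1, r.injEq]
    grind
  have hev : ∀ l : ℕ, ∀ i, (g ^ (2 * l)) (r i) = r (i + (l : ZMod n) * (2 + s)) := by
    intro l i
    rw [pow_mul]
    induction l with
    | zero => simp
    | succ l ih =>
      rw [pow_succ', Perm.mul_apply, ih, hsq, r.injEq]
      push_cast; ring
  have hev' : ∀ l i : ZMod n, ∃ j : ℕ, (g ^ j) (r i) = r (i + 2 * l) := by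
    intro l i
    refine ⟨2 * (e * l).val, ?_⟩
    rw [hev, ZMod.natCast_zmod_val, r.injEq]
    linear_combination l * he
  obtain ⟨k, rfl⟩ : ∃ k : ℕ, (k : ZMod n) = m := ⟨m.val, ZMod.natCast_zmod_val m⟩
  obtain ⟨l, rfl | rfl⟩ := Nat.even_or_odd' k
  · obtain ⟨j, hj⟩ := hev' l 0
    exact ⟨j, by rw [hj]; simp⟩
  · obtain ⟨j, hj⟩ := hev' l 1
    refine ⟨j + 1, ?_⟩
    rw [pow_succ, Perm.mul_apply, (hg 0).1, mul_zero, zero_add, hj]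
    push_cast; rw [add_comm]

theorem exists_hom_range_eq_blockGroup [NeZero n] {u s : ZMod n} (hu : u * u = 1)
    (hs : IsTwist s) :
    ∃ f : DihedralGroup n →* Perm (DihedralGroup n), Function.Injective f ∧
      f.range = blockGroup u s hu hs ∧
      (∀ i, ∃ m, IsPreserving (f (r i)) (1 + s * m) m (u * m)) ∧
      ∀ m, ∃ i, IsPreserving (f (r i)) (1 + s * m) m (u * m) := by
  have h1 := hs.add_self
  have h2 := hs.mul_self
  have h3 := mul_unit_of_add_self h1 hu
  have hreg := isRegularSubgroup_blockGroup (hu := hu) (hs := hs)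
  obtain ⟨k, hkM, hk⟩ := exists_preserving_mem hu hs 1
  obtain ⟨y, hyM, hy⟩ := exists_swapping_mem hu hs 0
  simp only [mul_one, mul_zero, zero_add] at hk hy
  have hpow : ∀ j : ℤ, ∃ m, IsPreserving (k ^ j) (1 + s * m) m (u * m) := by
    intro j
    obtain ⟨i, hi⟩ := ((isOfFinOrder_of_finite k).mem_powers_iff_mem_zpowers).mpr
      ⟨j, rfl⟩
    obtain ⟨m, hm⟩ := hk.exists_pow_of_isTwist hs i
    simp only at hi
    rw [one_mul, hi] at hm
    exact ⟨m, hm⟩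
  have htrans : ∀ m, ∃ j : ℤ, IsPreserving (k ^ j) (1 + s * m) m (u * m) := by
    intro m
    obtain ⟨j, hj⟩ := hk.exists_pow_apply_eq hs m
    obtain ⟨m', hm'⟩ := hpow j
    rw [zpow_natCast] at hm'
    have := (hm' 0).1
    rw [hj, mul_zero, zero_add, r.injEq] at this
    subst this
    exact ⟨j, by rwa [zpow_natCast]⟩
  -- The parameter `m` identifies `ZMod n` with the powers of `k`, so `k` has order `n`.
  have hkn : k ^ n = 1 := by
    choose J hJ using htrans
    have hbij : Function.Bijective (fun m => (⟨k ^ J m, J m, rfl⟩ : Subgroup.zpowers k)) := by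
      constructor
      · intro m m' h
        have h := congrArg Subtype.val h
        simp only at h
        exact ((h ▸ hJ m).unique (hJ m')).2.1
      · rintro ⟨_, j, rfl⟩
        obtain ⟨m, hm⟩ := hpow j
        exact ⟨m, Subtype.ext ((hJ m).ext hm)⟩
    have hcard := Nat.card_eq_of_bijective _ hbij
    rw [Nat.card_zpowers, Nat.card_zmod] at hcard
    exact orderOf_dvd_iff_pow_eq_one.mp hcard.symm.dvd
  have hyy : y * y = 1 := by
    refine IsPreserving.ext (hy.mul_swapping hy) ?_
    convert isPreserving_one using 1 <;> grind
  have hyk : y * k * y⁻¹ = k⁻¹ := by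
    rw [mul_inv_eq_iff_eq_mul]
    refine IsSwapping.ext (hy.mul_preserving hk) ?_
    have := (hk.inv (c' := 1 + s) (by grind)).mul_swapping hy
    convert this using 1 <;> grind
  obtain ⟨f, hfr, hfsr⟩ := exists_dihedral_hom hkn hyy hyk
  have hr : ∀ i, ∃ m, IsPreserving (f (r i)) (1 + s * m) m (u * m) := fun i => by
    obtain ⟨i, rfl⟩ := ZMod.intCast_surjective i
    rw [hfr]; exact hpow i
  have hr' : ∀ m, ∃ i, IsPreserving (f (r i)) (1 + s * m) m (u * m) := fun m => by
    obtain ⟨j, hj⟩ := htrans m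
    exact ⟨j, by rwa [hfr]⟩
  have hsurj : ∀ x, ∃ z, f z (r 0) = x := by
    rintro (m | m)
    · obtain ⟨i, hi⟩ := hr' m
      exact ⟨r i, by rw [(hi 0).1, mul_zero, zero_add]⟩
    · obtain ⟨i, hi⟩ := hr' ((-u + s) * m)
      have hfy : f (sr 0) = y := by simpa using hfsr 0
      refine ⟨sr i, ?_⟩
      rw [← zero_add i, ← sr_mul_r, map_mul, Perm.mul_apply, (hi 0).1, hfy, (hy _).1, sr.injEq]
      grind
  have hinj : Function.Injective fun z => f z (r 0) := Finite.injective_iff_surjective.mpr hsurj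
  have hmem : ∀ z, f z ∈ blockGroup u s hu hs := by
    rintro (i | i) <;> obtain ⟨i, rfl⟩ := ZMod.intCast_surjective i
    · rw [hfr]; exact zpow_mem hkM i
    · rw [hfsr]; exact mul_mem hyM (zpow_mem hkM i)
  refine ⟨f, fun z z' h => hinj (congrArg (· (r 0)) h), le_antisymm ?_ fun g hg => ?_, hr, hr'⟩
  · rintro _ ⟨z, rfl⟩
    exact hmem z
  · obtain ⟨z, hz⟩ := hsurj (g (r 0))
    exact ⟨z, hreg.eq_of_apply_eq (hmem z) hg hz⟩

theorem range_rotation_orbits_eq_iff {f : DihedralGroup n →* Perm (DihedralGroup n)} :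
    Set.range (fun x => Set.range fun i => f (r i) x) = {X0 n, Y0 n} ↔
      (∀ j, (Set.range fun i => f (r i) (r j)) = X0 n) ∧
      ∀ j, (Set.range fun i => f (r i) (sr j)) = Y0 n := by
  have hself : ∀ x, x ∈ Set.range fun i => f (r i) x := fun x => ⟨0, by simp⟩
  constructor
  · intro h
    constructor
    · intro j
      have h1 : (Set.range fun i => f (r i) (r j)) ∈ ({X0 n, Y0 n} : Set _) := h ▸ ⟨r j, rfl⟩
      rcases h1 with h1 | h1
      · exact h1
      · have := h1 ▸ hself (r j)
        obtain ⟨i, hi⟩ := this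
        cases hi
    · intro j
      have h1 : (Set.range fun i => f (r i) (sr j)) ∈ ({X0 n, Y0 n} : Set _) := h ▸ ⟨sr j, rfl⟩
      rcases h1 with h1 | h1
      · have := h1 ▸ hself (sr j)
        obtain ⟨i, hi⟩ := this
        cases hi
      · exact h1
  · rintro ⟨h1, h2⟩
    ext S
    constructor
    · rintro ⟨j | j, rfl⟩
      · exact Or.inl (h1 j)
      · exact Or.inr (h2 j)
    · rintro (rfl | rfl)
      · exact ⟨r 0, h1 0⟩
      · exact ⟨sr 0, h2 0⟩

theorem blockGroup_mem_classRW [NeZero n] (hn : 2 < n) {u s : ZMod n} (hu : u * u = 1)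
    (hs : IsTwist s) :
    blockGroup u s hu hs ∈
      classRW (leftReg (DihedralGroup n)) (leftReg (DihedralGroup n)) (X0 n) (Y0 n) := by
  have h1 := hs.add_self
  have h2 := hs.mul_self
  have h3 := mul_unit_of_add_self h1 hu
  obtain ⟨f, hf, hfM, hr, hr'⟩ := exists_hom_range_eq_blockGroup hu hs
  refine ⟨⟨isRegularSubgroup_blockGroup, leftReg_le_hol_blockGroup,
    hfM ▸ nonempty_mulEquiv_leftReg hf⟩, ?_⟩
  rw [← hfM, charBlocks_iff hn hf, range_rotation_orbits_eq_iff]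
  refine ⟨fun j => ?_, fun j => ?_⟩ <;> ext (m | m)
  · refine iff_of_true ?_ ⟨m, rfl⟩
    obtain ⟨i, hi⟩ := hr' ((1 + s * j) * (m - j))
    refine ⟨i, (hi j).1.trans ?_⟩
    rw [r.injEq]
    grind
  · refine iff_of_false ?_ (by rintro ⟨i, hi⟩; cases hi)
    rintro ⟨i, hi⟩
    obtain ⟨x, hx⟩ := hr i
    simp [(hx j).1] at hi
  · refine iff_of_false ?_ (by rintro ⟨i, hi⟩; cases hi)
    rintro ⟨i, hi⟩
    obtain ⟨x, hx⟩ := hr i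
    simp [(hx j).2] at hi
  · refine iff_of_true ?_ ⟨m, rfl⟩
    obtain ⟨i, hi⟩ := hr' ((u + s * j) * (m - j))
    refine ⟨i, (hi j).2.trans ?_⟩
    rw [sr.injEq]
    grind

theorem blockGroup_mem_calR [NeZero n] (hn : 2 < n) {u s : ZMod n} (hu : u * u = 1)
    (hs : IsTwist s) : blockGroup u s hu hs ∈ calR (DihedralGroup n) :=
  (blockGroup_mem_classRW hn hu hs).1

/-- `λ(D_n)` is itself the block group with `u = -1` and twist `0`, for which the parity condition
is vacuous. -/
theorem blockGroup_mem_calS [NeZero n] (hn : 2 < n) {u s : ZMod n} (hu : u * u = 1)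
    (hs : IsTwist s) : blockGroup u s hu hs ∈ calS (DihedralGroup n) := by
  have h1 := hs.add_self
  have h2 := hs.mul_self
  have h3 := mul_unit_of_add_self h1 hu
  obtain ⟨⟨hreg, -, hiso⟩, -⟩ := blockGroup_mem_classRW hn hu hs
  refine ⟨?_, hreg, hiso⟩
  rw [leftReg_eq_blockGroup]
  rintro g (⟨m, hg⟩ | ⟨m, hg⟩)
  · exact hg.mem_hol_blockGroup (c' := 1 + s * m) (by grind) (by simp)
  · exact hg.mem_hol_blockGroup (c' := -u + s * (m + 1)) (by grind) (by simp)

/-! ### Classification of the groups with blocks `X0`, `Y0` -/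

theorem eq_of_add_self_eq_zero [NeZero n] {x y : ZMod n} (hx : x + x = 0) (hy : y + y = 0)
    (hx0 : x ≠ 0) (hy0 : y ≠ 0) : x = y := by
  have key : ∀ z : ZMod n, z + z = 0 → z ≠ 0 → z.val + z.val = n := by
    intro z hz hz0
    have h1 : n ∣ z.val + z.val := by
      rw [← ZMod.natCast_eq_zero_iff]
      push_cast
      rw [ZMod.natCast_zmod_val, hz]
    have h2 : 0 < z.val := ZMod.val_pos.mpr hz0
    have h3 := ZMod.val_lt z
    obtain ⟨k, hk⟩ := h1
    have : k = 1 := by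
      rcases k with _ | _ | k
      · omega
      · rfl
      · nlinarith
    rw [hk, this, mul_one]
  have h1 := key x hx hx0
  have h2 := key y hy hy0
  exact ZMod.val_injective n (by omega)

section

variable {f : DihedralGroup n →* Perm (DihedralGroup n)}

theorem apply_r_zero (x : DihedralGroup n) : f (r 0) x = x := by
  rw [r_zero, map_one, Perm.one_apply]

theorem apply_r_injective (hf : Function.Injective f) (hreg : IsRegularSubgroup f.range)
    {x : DihedralGroup n} {i j : ZMod n} (h : f (r i) x = f (r j) x) : i = j :=
  r.inj (hf (hreg.eq_of_apply_eq ⟨_, rfl⟩ ⟨_, rfl⟩ h))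

/-- The multiplier by which left translation by a rotation acts on the rotation subgroup of a
regular dihedral group squares to one. -/
theorem multiplier_mul_self [NeZero n] (hn : 2 < n) (hf : Function.Injective f)
    (hle : leftReg (DihedralGroup n) ≤ Hol f.range) {a : ZMod n}
    (ha : ∀ i, MulAction.toPermHom (DihedralGroup n) (DihedralGroup n) (r 1) * f (r i) =
      f (r (a * i)) * MulAction.toPermHom (DihedralGroup n) (DihedralGroup n) (r 1)) :
    a * a = 1 := by
  set l := MulAction.toPermHom (DihedralGroup n) (DihedralGroup n) with hl
  obtain ⟨b, hb⟩ := exists_conj_rotation hn hf (hle ⟨sr 0, rfl⟩)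
  rw [← hl] at hb
  have hbb : b * b = 1 := by
    have h1 : l (sr 0) * (l (sr 0) * f (r 1)) = f (r (b * (b * 1))) * (l (sr 0) * l (sr 0)) := by
      rw [hb, ← mul_assoc, hb, mul_assoc]
    rw [← mul_assoc, ← map_mul, sr_mul_self, map_one, one_mul, mul_one] at h1
    have := hf h1
    rw [r.injEq, mul_one] at this
    exact this.symm
  -- The relation `r 1 * sr 0 * r 1 = sr 0` becomes `a b a = b` on exponents.
  have h1 : l (r 1) * (l (sr 0) * (l (r 1) * f (r 1))) =
      f (r (a * (b * (a * 1)))) * (l (r 1) * (l (sr 0) * l (r 1))) := by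
    rw [ha, ← mul_assoc (l (sr 0)), hb, ← mul_assoc, ← mul_assoc, ha, mul_assoc, mul_assoc]
  have h2 : l (r 1) * (l (sr 0) * l (r 1)) = l (sr 0) := by
    rw [← map_mul, ← map_mul, sr_mul_r, r_mul_sr]; congr 2; ring
  have h3 : l (r 1) * (l (sr 0) * (l (r 1) * f (r 1))) = f (r (b * 1)) * l (sr 0) := by
    conv_rhs => rw [← hb, ← h2]
    simp only [mul_assoc]
  rw [h2, h3] at h1
  have := hf (mul_right_cancel h1)
  rw [r.injEq] at this
  linear_combination (a * a - 1) * (-hbb) - b * this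

/-- The exponents `x` carrying `r 0` to `r m` obey the recursion `x ↦ a x + c`, so they stay in two
cosets of the ideal `(a + 1)`. These cosets exhaust `ZMod n`, hence `a + 1` divides `2`; with `a² =
1` this gives `2 (a - 1) = 0`. -/
theorem isTwist_of_multiplier [NeZero n] (hf : Function.Injective f)
    (hreg : IsRegularSubgroup f.range) {a : ZMod n} (haa : a * a = 1)
    (ha : ∀ i, MulAction.toPermHom (DihedralGroup n) (DihedralGroup n) (r 1) * f (r i) =
      f (r (a * i)) * MulAction.toPermHom (DihedralGroup n) (DihedralGroup n) (r 1))
    (horb : (Set.range fun i => f (r i) (r 0)) = X0 n) : IsTwist (a - 1) := by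
  obtain ⟨c, hc⟩ : r 1 ∈ Set.range fun i => f (r i) (r 0) := horb ▸ ⟨1, rfl⟩
  simp only at hc
  have hpow : ∀ m : ℕ, ∃ x, f (r x) (r 0) = r m ∧
      ∃ l, x = l * (a + 1) ∨ x = c + l * (a + 1) := by
    intro m
    induction m with
    | zero => exact ⟨0, by rw [apply_r_zero, Nat.cast_zero], 0, by simp⟩
    | succ m ih =>
      obtain ⟨x, hx, l, hl⟩ := ih
      refine ⟨a * x + c, ?_, ?_⟩
      · have := congrArg (· (r 0)) (ha x)
        simp only [Perm.mul_apply, hx, (isPreserving_left_r 1 _).1, mul_zero, zero_add,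
          one_mul] at this
        rw [← hc, ← Perm.mul_apply, ← map_mul, r_mul_r] at this
        rw [← this]
        push_cast; congr 1
      · rcases hl with rfl | rfl
        · exact ⟨a * l, Or.inr (by ring)⟩
        · exact ⟨c + a * l, Or.inl (by ring)⟩
  have hall : ∀ x : ZMod n, ∃ l, x = l * (a + 1) ∨ x = c + l * (a + 1) := by
    intro x
    obtain ⟨m, hm⟩ : f (r x) (r 0) ∈ X0 n := horb ▸ ⟨x, rfl⟩
    obtain ⟨x', hx', h⟩ := hpow m.val
    rw [ZMod.natCast_zmod_val, hm] at hx'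
    rwa [← apply_r_injective hf hreg hx']
  have h2 : ∃ e, (a + 1) * e = 2 := by
    obtain ⟨l, hl⟩ := hall 1
    obtain ⟨k, hk⟩ := hall 2
    rcases hl with hl | hl
    · exact ⟨2 * l, by linear_combination -2 * hl⟩
    rcases hk with hk | hk
    · exact ⟨k, by linear_combination -hk⟩
    · exact ⟨2 * (k - l), by linear_combination 2 * hl - 2 * hk⟩
  obtain ⟨e, he⟩ := h2
  have h3 : (a - 1) + (a - 1) = 0 := by linear_combination (1 - a) * he + e * haa
  exact ⟨h3, by linear_combination haa - h3, e, by linear_combination he⟩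

/-- A permutation which preserves the two cosets and commutes with left translation by the
rotation up to the translation by `s` is affine. -/
theorem isPreserving_of_step [NeZero n] {g h : Perm (DihedralGroup n)} {s p q : ZMod n}
    (hh : IsPreserving h 1 s s) (hs : s + s = 0)
    (hcomm : MulAction.toPermHom (DihedralGroup n) (DihedralGroup n) (r 1) * g =
      h * g * MulAction.toPermHom (DihedralGroup n) (DihedralGroup n) (r 1))
    (hX : ∀ i, ∃ j, g (r i) = r j) (hY : ∀ i, ∃ j, g (sr i) = sr j)
    (hp : g (r 0) = r p) (hq : g (sr 0) = sr q) : IsPreserving g (1 + s) p q := by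
  have hρ := isPreserving_left_r (1 : ZMod n)
  choose x hx using hX
  choose y hy using hY
  have hxs : ∀ i, x (i + 1) = x i + (1 + s) := by
    intro i
    have := congrArg (· (r i)) hcomm
    simp only [Perm.mul_apply, (hρ _).1, hx, (hh _).1, r.injEq, one_mul] at this
    linear_combination -hs - this
  have hys : ∀ i, y (i + 1) = y i + (1 + s) := by
    intro i
    have := congrArg (· (sr (i + 1))) hcomm
    simp only [Perm.mul_apply, (hρ _).2, hy, (hh _).2, sr.injEq, one_mul,
      add_neg_cancel_right] at this
    linear_combination this
  have hx0 : x 0 = p := by rw [hx, r.injEq] at hp; exact hp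
  have hy0 : y 0 = q := by rw [hy, sr.injEq] at hq; exact hq
  have key : ∀ z : ZMod n → ZMod n, (∀ i, z (i + 1) = z i + (1 + s)) →
      ∀ i, z i = (1 + s) * i + z 0 := by
    intro z hz i
    obtain ⟨m, rfl⟩ : ∃ m : ℕ, (m : ZMod n) = i := ⟨i.val, ZMod.natCast_zmod_val i⟩
    induction m with
    | zero => simp
    | succ m ih => rw [Nat.cast_succ, hz, ih]; ring
  intro i
  rw [hx, hy, key x hxs, key y hys, hx0, hy0]
  exact ⟨rfl, rfl⟩

/-- Commuting with left translation by `r 1` makes the map a translation on each block. Both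
translation parts are 2-torsion and, by regularity, vanish only if `s` does; nonzero 2-torsion in
`ZMod n` is unique. -/
theorem isPreserving_involution [NeZero n] (hf : Function.Injective f)
    (hreg : IsRegularSubgroup f.range) {s : ZMod n} (hs : s + s = 0)
    (hcomm : MulAction.toPermHom (DihedralGroup n) (DihedralGroup n) (r 1) * f (r s) =
      f (r s) * MulAction.toPermHom (DihedralGroup n) (DihedralGroup n) (r 1))
    (hX : ∀ i, ∃ j, f (r s) (r i) = r j) (hY : ∀ i, ∃ j, f (r s) (sr i) = sr j) :
    IsPreserving (f (r s)) 1 s s := by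
  obtain ⟨p, hp⟩ := hX 0
  obtain ⟨q, hq⟩ := hY 0
  have h1 : IsPreserving (1 : Perm (DihedralGroup n)) 1 0 0 := isPreserving_one
  have h := isPreserving_of_step h1 (add_zero 0) (by rw [one_mul]; exact hcomm) hX hY hp hq
  rw [add_zero] at h
  have hsq := h.mul_preserving h
  rw [← map_mul, r_mul_r, hs, r_zero, map_one] at hsq
  obtain ⟨-, hp2, hq2⟩ := h1.unique hsq
  have key : ∀ x, (s = 0 ↔ x = 0) → 0 = 1 * x + x → x = s := by
    intro x hx hxx
    by_cases h0 : s = 0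
    · rw [h0, hx.mp h0]
    · exact eq_of_add_self_eq_zero (by linear_combination -hxx) hs (fun h => h0 (hx.mpr h)) h0
  have hp0 : s = 0 ↔ p = 0 := by
    constructor
    · rintro rfl; rw [apply_r_zero, r.injEq] at hp; exact hp.symm
    · rintro rfl
      refine apply_r_injective hf hreg (x := r 0) ?_
      rw [hp, apply_r_zero]
  have hq0 : s = 0 ↔ q = 0 := by
    constructor
    · rintro rfl; rw [apply_r_zero, sr.injEq] at hq; exact hq.symm
    · rintro rfl
      refine apply_r_injective hf hreg (x := sr 0) ?_
      rw [hq, apply_r_zero]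
  rwa [key p hp0 hp2, key q hq0 hq2] at h

end

/-- Every member of `R(D_n, [D_n]; W(X0, Y0))` is one of the explicit block groups. -/
theorem exists_eq_blockGroup_of_mem_classRW [NeZero n] (hn : 2 < n)
    {N : Subgroup (Perm (DihedralGroup n))}
    (hN : N ∈ classRW (leftReg (DihedralGroup n)) (leftReg (DihedralGroup n)) (X0 n) (Y0 n)) :
    ∃ (u s : ZMod n) (hu : u * u = 1) (hs : IsTwist s), N = blockGroup u s hu hs := by
  obtain ⟨⟨hreg, hle, hiso⟩, hblocks⟩ := hN
  obtain ⟨f, hf, rfl⟩ := exists_hom_range_eq hiso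
  rw [charBlocks_iff hn hf, range_rotation_orbits_eq_iff] at hblocks
  obtain ⟨horbX, horbY⟩ := hblocks
  have hX : ∀ m i, ∃ j, f (r m) (r i) = r j := fun m i => by
    obtain ⟨j, hj⟩ : f (r m) (r i) ∈ X0 n := horbX i ▸ ⟨m, rfl⟩
    exact ⟨j, hj.symm⟩
  have hY : ∀ m i, ∃ j, f (r m) (sr i) = sr j := fun m i => by
    obtain ⟨j, hj⟩ : f (r m) (sr i) ∈ Y0 n := horbY i ▸ ⟨m, rfl⟩
    exact ⟨j, hj.symm⟩
  obtain ⟨a, ha⟩ := exists_conj_rotation hn hf (hle ⟨r 1, rfl⟩)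
  have haa := multiplier_mul_self hn hf hle ha
  have hs := isTwist_of_multiplier hf hreg haa ha (horbX 0)
  obtain ⟨s, rfl⟩ : ∃ s, a = 1 + s := ⟨a - 1, by ring⟩
  rw [add_sub_cancel_left] at hs
  have h1 := hs.add_self
  have h2 := hs.mul_self
  -- `(1 + s) s = s` gives the commutation. Knowing `f (r s)`, the relation for `f (r 1)` becomes a
  -- first-order recursion on each block.
  have hinv : IsPreserving (f (r s)) 1 s s := by
    refine isPreserving_involution hf hreg h1 ?_ (hX s) (hY s)
    rw [ha]; congr 3; linear_combination h2
  obtain ⟨p, hp⟩ := hX 1 0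
  obtain ⟨q, hq⟩ := hY 1 0
  have hk : IsPreserving (f (r 1)) (1 + s) p q := by
    refine isPreserving_of_step hinv h1 ?_ (hX 1) (hY 1) hp hq
    rw [ha, ← map_mul, r_mul_r]; congr 3; ring
  have hpow : ∀ m, ∃ x, IsPreserving (f (r m)) (1 + s * x) (p * x) (q * x) := fun m => by
    rw [r_eq_r_one_pow_val, map_pow]
    exact hk.exists_pow_of_isTwist hs _
  obtain ⟨p', hp'⟩ : ∃ p', p * p' = 1 := by
    obtain ⟨m, hm⟩ : r 1 ∈ Set.range fun i => f (r i) (r 0) := horbX 0 ▸ ⟨1, rfl⟩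
    obtain ⟨x, hx⟩ := hpow m
    simp only [(hx 0).1, mul_zero, zero_add, r.injEq] at hm
    exact ⟨x, hm⟩
  obtain ⟨u, rfl⟩ : ∃ u, q = u * p := ⟨q * p', by linear_combination -q * hp'⟩
  -- Left translation by `sr 0` exchanges the translation parts `p`, `u p`, and the conjugate is a
  -- rotation with parts `p x`, `u p x`.
  have hu : u * u = 1 := by
    obtain ⟨b, hb⟩ := exists_conj_rotation hn hf (hle ⟨sr 0, rfl⟩)
    obtain ⟨x, hx⟩ := hpow (b * 1)
    have ht := isSwapping_left_sr (0 : ZMod n)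
    have h3 := congrArg (· (r 0)) (hb 1)
    have h4 := congrArg (· (sr 0)) (hb 1)
    simp only [Perm.mul_apply, (ht _).1, (ht _).2, (hk _).1, (hk _).2, (hx _).1, (hx _).2,
      r.injEq, sr.injEq] at h3 h4
    grind
  have h3 := mul_unit_of_add_self h1 hu
  have h4 := mul_unit_of_add_self h1 hp'
  have hr : ∀ m, ∃ x, IsPreserving (f (r m)) (1 + s * x) x (u * x) := fun m => by
    obtain ⟨x, hx⟩ := hpow m
    refine ⟨p * x, ?_⟩
    convert hx using 1 <;> grind
  have hrmem : ∀ m, f (r m) ∈ blockGroup u s hu hs := fun m => Or.inl (hr m)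
  refine ⟨u, s, hu, hs, hreg.eq_of_le isRegularSubgroup_blockGroup ?_⟩
  obtain ⟨j, hj⟩ : ∃ j, f (sr j) (r 0) = sr 0 := by
    obtain ⟨_, ⟨z | z, rfl⟩, hz⟩ := (isRegularSubgroup_iff.mp hreg).1 (r 0) (sr 0)
    · obtain ⟨i, hi⟩ := hX z 0
      rw [hi] at hz; cases hz
    · exact ⟨z, hz⟩
  -- A reflection inverts rotations, so its value at `f (r m) (r 0)` is `(f (r m))⁻¹ (sr 0)`; on
  -- `Y0` it is then determined by being an involution.
  have hy : IsSwapping (f (sr j)) (-u + s) 0 0 := by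
    have hyX : ∀ i, f (sr j) (r i) = sr ((-u + s) * i + 0) := by
      intro i
      obtain ⟨m, hm⟩ : r i ∈ Set.range fun i => f (r i) (r 0) := horbX 0 ▸ ⟨i, rfl⟩
      simp only at hm
      obtain ⟨x, hx⟩ := hr m
      have hxi : x = i := by rw [(hx 0).1, r.injEq] at hm; linear_combination hm
      subst hxi
      have h5 := mul_sq_of_add_self h1 x
      have h6 := hx.inv (c' := 1 + s * x) (by grind)
      have h7 : f (sr j) * f (r m) = (f (r m))⁻¹ * f (sr j) := by
        rw [← map_mul, ← map_inv, inv_r, ← map_mul, sr_mul_r, r_mul_sr, sub_neg_eq_add]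
      rw [← hm, ← Perm.mul_apply, h7, Perm.mul_apply, hj, (h6 0).2, sr.injEq]
      grind
    have hyy : ∀ z, f (sr j) (f (sr j) z) = z := fun z => by
      rw [← Perm.mul_apply, ← map_mul, sr_mul_self, map_one, Perm.one_apply]
    intro i
    refine ⟨hyX i, ?_⟩
    have := hyy (r ((-u + s) * i + 0))
    rw [hyX] at this
    convert this using 3
    grind
  have hymem : f (sr j) ∈ blockGroup u s hu hs :=
    Or.inr ⟨0, by convert hy using 1 <;> ring⟩
  rintro _ ⟨i | i, rfl⟩
  · exact hrmem i
  · have : sr i = sr j * r (i - j) := by rw [sr_mul_r, add_sub_cancel]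
    rw [this, map_mul]
    exact mul_mem hymem (hrmem _)

/-! ### Groups in `𝒮 ∩ ℛ` normalize every block group -/

theorem IsSwapping.twist_mul_eq_of_involution [NeZero n] {g : Perm (DihedralGroup n)}
    {c c' p q s : ZMod n} (hg : IsSwapping g c p q) (hc : c * c' = 1) (hs : s + s = 0)
    (hgg : g * g = 1) : s * p = s * q := by
  have h := hg.mul_swapping hg
  rw [hgg] at h
  have h1 := (h.unique isPreserving_one).2.1
  have h2 := mul_unit_of_add_self hs hc
  linear_combination s * h1 - p * h2 - q * hs

/-- If a rotation of a regular dihedral group normalized by left translations swaps the two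
cosets, then its square respects the parity of exponents. -/
theorem twist_mul_eq_of_swapping_rotation [NeZero n] (hn : 2 < n)
    {f : DihedralGroup n →* Perm (DihedralGroup n)} (hf : Function.Injective f)
    (hreg : IsRegularSubgroup f.range) (hle : leftReg (DihedralGroup n) ≤ Hol f.range)
    {c c' p q s : ZMod n} (hk : IsSwapping (f (r 1)) c p q) (hc : c * c' = 1)
    (hs : s + s = 0) : s * p = s * q := by
  by_contra hne
  -- `H` is the trace on `X0` of the rotation orbit of `r 0`. Normalization by left translations
  -- makes it a subgroup, of index at most `2` since there are only two rotation orbits.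
  let H : Set (ZMod n) := {i | ∃ m, f (r m) (r 0) = r i}
  have hmul : ∀ i j x, f (r i) (f (r j) x) = f (r (i + j)) x := fun i j x => by
    rw [← r_mul_r, map_mul, Perm.mul_apply]
  have hdiff : ∀ {m i j}, f (r m) (r i) = r j → j - i ∈ H := by
    intro m i j h
    obtain ⟨a, ha⟩ := exists_conj_rotation hn hf (hle ⟨r (-i), rfl⟩)
    have h1 := congrArg (· (r i)) (ha m)
    have hl := isPreserving_left_r (-i)
    simp only [Perm.mul_apply, h, (hl _).1] at h1
    refine ⟨a * m, ?_⟩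
    convert h1.symm using 2 <;> ring_nf
  have hneg : ∀ {i}, i ∈ H → -i ∈ H := by
    rintro i ⟨m, hm⟩
    have : f (r (-m)) (r i) = r 0 := by rw [← hm, hmul, neg_add_cancel, apply_r_zero]
    simpa using hdiff this
  have hsub : ∀ {i j}, i ∈ H → j ∈ H → j - i ∈ H := by
    rintro i j ⟨m, hm⟩ ⟨m', hm'⟩
    have : f (r (m' - m)) (r i) = r j := by rw [← hm, hmul, sub_add_cancel, hm']
    exact hdiff this
  have hadd : ∀ {i j}, i ∈ H → j ∈ H → i + j ∈ H := fun {i j} hi hj => by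
    simpa [add_comm] using hsub (hneg hi) hj
  have hzero : (0 : ZMod n) ∈ H := ⟨0, apply_r_zero _⟩
  have hnat : ∀ {i}, i ∈ H → ∀ l : ℕ, (l : ZMod n) * i ∈ H := by
    intro i hi l
    induction l with
    | zero => simpa using hzero
    | succ l ih => rw [Nat.cast_succ, add_mul, one_mul]; exact hadd ih hi
  have hcompl : ∀ {i j}, i ∉ H → j ∉ H → j - i ∈ H := by
    intro i j hi hj
    have key : ∀ {i}, i ∉ H → ∃ a, f (sr a) (r 0) = r i := by
      intro i hi
      obtain ⟨_, ⟨z | z, rfl⟩, hz⟩ := (isRegularSubgroup_iff.mp hreg).1 (r 0) (r i)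
      · exact absurd ⟨z, hz⟩ hi
      · exact ⟨z, hz⟩
    obtain ⟨a, ha⟩ := key hi
    obtain ⟨b, hb⟩ := key hj
    have : f (r (a - b)) (r i) = r j := by
      rw [← ha, ← Perm.mul_apply, ← map_mul, r_mul_sr, sub_sub_cancel, hb]
    exact hdiff this
  -- Otherwise `X0` lies in one orbit of the rotations; as `f (r 1)` swaps the blocks, `n` rotations
  -- would reach all `2 n` points.
  have hone : (1 : ZMod n) ∉ H := by
    intro h1
    have hall : ∀ i, i ∈ H := fun i => by
      have := hnat h1 i.val
      rwa [ZMod.natCast_zmod_val, mul_one] at this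
    have hsurj : Function.Surjective fun m => f (r m) (r 0) := by
      rintro (i | i)
      · exact hall i
      · obtain ⟨m, hm⟩ := hall (c' * (i - p))
        refine ⟨1 + m, ?_⟩
        simp only
        rw [← hmul, hm, (hk _).1, sr.injEq]
        linear_combination (i - p) * hc
    have := Nat.card_le_card_of_surjective _ hsurj
    rw [nat_card, Nat.card_zmod] at this
    omega
  have htwo : (2 : ZMod n) ∈ H := by
    have := hcompl (i := -1) (j := 1) (fun h => hone (by simpa using hneg h)) hone
    rwa [sub_neg_eq_add, one_add_one_eq_two] at this
  -- The square of `f (r 1)` sends `r 0` to `r (c p + q)`. Since `2 ∈ H` and `1 ∉ H`, this element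
  -- is even, hence killed by `s`.
  have hx : c * p + q ∈ H := by
    refine ⟨1 + 1, ?_⟩
    rw [← hmul, (hk _).1, (hk _).2, r.injEq]; ring
  have hsc := mul_unit_of_add_self hs hc
  obtain ⟨l, hl⟩ := Nat.even_or_odd' (c * p + q).val
  have hval : (((c * p + q).val : ℕ) : ZMod n) = c * p + q := ZMod.natCast_zmod_val _
  rcases hl with hl | hl <;> rw [hl] at hval <;> push_cast at hval
  · apply hne
    linear_combination p * hsc * (-1) - s * hval + (l - q) * hs
  · have := hsub (hnat htwo l) hx
    rw [← hval] at this
    apply hone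
    convert this using 1
    ring

/-- Elements of a regular dihedral group inside the holomorph of the left regular
representation and normalized by it act compatibly with parity. -/
theorem exists_parity_of_mem_range [NeZero n] (hn : 2 < n)
    {f : DihedralGroup n →* Perm (DihedralGroup n)} (hf : Function.Injective f)
    (hreg : IsRegularSubgroup f.range) (hle : leftReg (DihedralGroup n) ≤ Hol f.range)
    (hle' : f.range ≤ Hol (leftReg (DihedralGroup n))) {s : ZMod n} (hs : s + s = 0)
    (z : DihedralGroup n) :
    ∃ c c' p q, c * c' = 1 ∧ s * p = s * q ∧
      (IsPreserving (f z) c p q ∨ IsSwapping (f z) c p q) := by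
  have hmul : ∀ {g h : Perm (DihedralGroup n)},
      (∃ c c' p q, c * c' = 1 ∧ s * p = s * q ∧ (IsPreserving g c p q ∨ IsSwapping g c p q)) →
      (∃ c c' p q, c * c' = 1 ∧ s * p = s * q ∧ (IsPreserving h c p q ∨ IsSwapping h c p q)) →
      ∃ c c' p q, c * c' = 1 ∧ s * p = s * q ∧
        (IsPreserving (g * h) c p q ∨ IsSwapping (g * h) c p q) := by
    rintro g h ⟨c, c', p, q, hc, hpq, hg⟩ ⟨d, d', v, w, hd, hvw, hh⟩
    have hcd : c * d * (c' * d') = 1 := by linear_combination d * d' * hc + hd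
    rcases hg with hg | hg <;> rcases hh with hh | hh
    · exact ⟨_, _, _, _, hcd, by linear_combination hpq + c * hvw, Or.inl (hg.mul_preserving hh)⟩
    · exact ⟨_, _, _, _, hcd, by linear_combination -hpq + c * hvw, Or.inr (hg.mul_swapping hh)⟩
    · exact ⟨_, _, _, _, hcd, by linear_combination hpq + c * hvw, Or.inr (hg.mul_preserving hh)⟩
    · exact ⟨_, _, _, _, hcd, by linear_combination -hpq + c * hvw, Or.inl (hg.mul_swapping hh)⟩
  obtain ⟨c, c', p, q, hc, hk⟩ := exists_of_mem_hol_leftReg hn (hle' ⟨r 1, rfl⟩)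
  obtain ⟨d, d', v, w, hd, hy⟩ := exists_of_mem_hol_leftReg hn (hle' ⟨sr 0, rfl⟩)
  have hsc := mul_unit_of_add_self hs hc
  have hsd := mul_unit_of_add_self hs hd
  have hdc : d * c * (d' * c') = 1 := by linear_combination c * c' * hd + hc
  have hyy : f (sr 0) * f (sr 0) = 1 := by rw [← map_mul, sr_mul_self, map_one]
  have hyk : f (sr 0) * f (r 1) * (f (sr 0) * f (r 1)) = 1 := by
    rw [← map_mul, ← map_mul, sr_mul_r, sr_mul_self, map_one]
  have hpow : (∀ m, f (r m) ∈ Submonoid.powers (f (r 1))) := fun m => by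
    exact ⟨m.val, by simp only; rw [r_eq_r_one_pow_val m, map_pow]⟩
  -- By transitivity some generator swaps the blocks. Among `sr 0` and `sr 0 * r 1`, those acting by
  -- swaps are handled as involutions; a swapping rotation needs the orbit argument.
  have hkv : s * p = s * q ∧ s * v = s * w := by
    rcases hk with hk | hk <;> rcases hy with hy | hy
    · exfalso
      have hX : ∀ m i, ∃ j, f (r m) (r i) = r j := by
        intro m
        obtain ⟨l, hl⟩ := hpow m
        simp only at hl
        rw [← hl]
        clear hl
        induction l with
        | zero => exact fun i => ⟨i, by simp⟩
        | succ l ih =>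
          intro i
          obtain ⟨j, hj⟩ := ih i
          exact ⟨_, by rw [pow_succ', Perm.mul_apply, hj, (hk _).1]⟩
      obtain ⟨_, ⟨z | z, rfl⟩, hz⟩ := (isRegularSubgroup_iff.mp hreg).1 (r 0) (sr 0)
      · obtain ⟨j, hj⟩ := hX z 0
        rw [hj] at hz; cases hz
      · obtain ⟨j, hj⟩ := hX z 0
        rw [← zero_add z, ← sr_mul_r, map_mul, Perm.mul_apply, hj, (hy _).1] at hz
        cases hz
    · have h1 := hy.twist_mul_eq_of_involution hd hs hyy
      have h2 := (hy.mul_preserving hk).twist_mul_eq_of_involution hdc hs hyk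
      exact ⟨by grind, h1⟩
    · have h1 := twist_mul_eq_of_swapping_rotation hn hf hreg hle hk hc hs
      have h2 := (hy.mul_swapping hk).twist_mul_eq_of_involution hdc hs hyk
      exact ⟨h1, by grind⟩
    · exact ⟨twist_mul_eq_of_swapping_rotation hn hf hreg hle hk hc hs,
        hy.twist_mul_eq_of_involution hd hs hyy⟩
  have hr : ∀ m, ∃ c c' p q, c * c' = 1 ∧ s * p = s * q ∧
      (IsPreserving (f (r m)) c p q ∨ IsSwapping (f (r m)) c p q) := by
    intro m
    obtain ⟨l, hl⟩ := hpow m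
    simp only at hl
    rw [← hl]
    clear hl
    induction l with
    | zero => exact ⟨1, 1, 0, 0, mul_one 1, rfl, Or.inl (by simpa using isPreserving_one)⟩
    | succ l ih =>
      rw [pow_succ]
      exact hmul ih ⟨c, c', p, q, hc, hkv.1, hk⟩
  rcases z with m | m
  · exact hr m
  · rw [← zero_add m, ← sr_mul_r, map_mul]
    exact hmul ⟨d, d', v, w, hd, hkv.2, hy⟩ (hr m)

theorem le_hol_blockGroup_of_mem [NeZero n] (hn : 2 < n) {u s : ZMod n} {hu : u * u = 1}
    {hs : IsTwist s} {N : Subgroup (Perm (DihedralGroup n))}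
    (hN : N ∈ calS (DihedralGroup n) ∩ calR (DihedralGroup n)) :
    N ≤ Hol (blockGroup u s hu hs) := by
  obtain ⟨⟨hle', hreg, hiso⟩, -, hle, -⟩ := hN
  obtain ⟨f, hf, rfl⟩ := exists_hom_range_eq hiso
  rintro _ ⟨z, rfl⟩
  obtain ⟨c, c', p, q, hc, hpq, h | h⟩ :=
    exists_parity_of_mem_range hn hf hreg hle hle' hs.add_self z
  · exact h.mem_hol_blockGroup hc hpq
  · exact h.mem_hol_blockGroup hc hpq

/-! ### Groups in `𝒬` have blocks `X0`, `Y0` -/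

/-- If `k = f (r 1)` swapped the blocks, then `g k g⁻¹ = w k` with `w` the translation by `2` and
`-2 c`. Then `w` is a rotation of the group, so it commutes with `k`, which gives `4 c = 0`; this is
where `n > 4` is needed. -/
theorem isPreserving_rotation_of_le_hol [NeZero n] (hn : 4 < n)
    {f : DihedralGroup n →* Perm (DihedralGroup n)} (hf : Function.Injective f)
    (hle' : f.range ≤ Hol (leftReg (DihedralGroup n)))
    {g : Perm (DihedralGroup n)} (hg : g ∈ Hol f.range) (hg2 : IsPreserving g 1 2 0) :
    ∃ c p q, IsPreserving (f (r 1)) c p q := by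
  obtain ⟨c, c', p, q, hc, hk | hk⟩ :=
    exists_of_mem_hol_leftReg (by omega) (hle' ⟨r 1, rfl⟩)
  · exact ⟨c, p, q, hk⟩
  exfalso
  obtain ⟨a, ha⟩ := exists_conj_rotation (by omega) hf hg
  obtain ⟨w, hw, hw'⟩ : ∃ w : Perm (DihedralGroup n),
      IsPreserving w 1 2 (-2 * c) ∧ w * f (r 1) = f (r 1) * w := by
    obtain ⟨w, hw⟩ := exists_isPreserving (one_mul (1 : ZMod n)) 2 (-2 * c)
    refine ⟨w, hw, ?_⟩
    have h1 : g * f (r 1) = w * f (r 1) * g := by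
      refine (hg2.mul_swapping hk).ext ?_
      convert (hw.mul_swapping hk).mul_preserving hg2 using 1 <;> ring
    have h2 : w = f (r (a * 1 - 1)) := by
      rw [ha] at h1
      have := mul_right_cancel h1
      rw [sub_eq_add_neg, ← r_mul_r, map_mul, this, ← inv_r, map_inv, mul_inv_cancel_right]
    rw [h2, ← map_mul, ← map_mul, r_mul_r, r_mul_r, add_comm]
  have h1 := congrArg (· (r 0)) hw'
  simp only [Perm.mul_apply, (hk _).1, (hw _).1, (hw _).2, sr.injEq] at h1
  apply four_ne_zero_of_four_lt hn
  linear_combination -c' * h1 - 4 * hc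

/-- The rotations act freely, and each block has as many points as there are rotations. -/
theorem rotation_orbits_of_isPreserving [NeZero n]
    {f : DihedralGroup n →* Perm (DihedralGroup n)} (hf : Function.Injective f)
    (hreg : IsRegularSubgroup f.range) {c p q : ZMod n} (hk : IsPreserving (f (r 1)) c p q) :
    Set.range (fun x => Set.range fun i => f (r i) x) = {X0 n, Y0 n} := by
  have hpow : ∀ m, ∃ c p q, IsPreserving (f (r m)) c p q := by
    intro m
    rw [r_eq_r_one_pow_val, map_pow]
    induction m.val with
    | zero => exact ⟨_, _, _, by simpa using isPreserving_one⟩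
    | succ l ih =>
      obtain ⟨_, _, _, h⟩ := ih
      rw [pow_succ]
      exact ⟨_, _, _, h.mul_preserving hk⟩
  have hX : ∀ j m, ∃ i, f (r m) (r j) = r i := fun j m => by
    obtain ⟨_, _, _, h⟩ := hpow m
    exact ⟨_, (h j).1⟩
  have hY : ∀ j m, ∃ i, f (r m) (sr j) = sr i := fun j m => by
    obtain ⟨_, _, _, h⟩ := hpow m
    exact ⟨_, (h j).2⟩
  rw [range_rotation_orbits_eq_iff]
  constructor
  · intro j
    choose x hx using hX j
    have hinj : Function.Injective x := fun m m' h =>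
      apply_r_injective hf hreg (x := r j) (by rw [hx, hx, h])
    ext y
    constructor
    · rintro ⟨m, rfl⟩
      exact ⟨x m, (hx m).symm⟩
    · rintro ⟨i, rfl⟩
      obtain ⟨m, rfl⟩ := Finite.surjective_of_injective hinj i
      exact ⟨m, hx m⟩
  · intro j
    choose x hx using hY j
    have hinj : Function.Injective x := fun m m' h =>
      apply_r_injective hf hreg (x := sr j) (by rw [hx, hx, h])
    ext y
    constructor
    · rintro ⟨m, rfl⟩
      exact ⟨x m, (hx m).symm⟩
    · rintro ⟨i, rfl⟩
      obtain ⟨m, rfl⟩ := Finite.surjective_of_injective hinj i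
      exact ⟨m, hx m⟩

theorem calQ_eq_classRW [NeZero n] (hn : 4 < n) :
    calQ (DihedralGroup n) =
      classRW (leftReg (DihedralGroup n)) (leftReg (DihedralGroup n)) (X0 n) (Y0 n) := by
  ext M
  have hmem : M ∈ calQ (DihedralGroup n) ↔
      ∀ N ∈ calS (DihedralGroup n) ∩ calR (DihedralGroup n),
        M ∈ calS (DihedralGroup n) ∩ calR (DihedralGroup n) ∧ N ≤ Hol M := by
    simp only [calQ, Set.mem_iInter₂, Set.mem_ofPred_eq]
  have hblock : ∀ (u s : ZMod n) (hu : u * u = 1) (hs : IsTwist s),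
      blockGroup u s hu hs ∈ calS (DihedralGroup n) ∩ calR (DihedralGroup n) :=
    fun u s hu hs =>
      ⟨blockGroup_mem_calS (by omega) hu hs, blockGroup_mem_calR (by omega) hu hs⟩
  rw [hmem]
  constructor
  · intro h
    -- The block group with `u = 1`, `s = 0` is the right regular representation.
    obtain ⟨⟨⟨hle', hreg, hiso⟩, hR⟩, hright⟩ := h _ (hblock 1 0 (one_mul 1) isTwist_zero)
    refine ⟨hR, ?_⟩
    obtain ⟨-, hle, -⟩ := hR
    obtain ⟨f, hf, rfl⟩ := exists_hom_range_eq hiso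
    rw [charBlocks_iff (by omega) hf]
    obtain ⟨g, hg, hg'⟩ := exists_preserving_mem (one_mul (1 : ZMod n)) isTwist_zero 1
    have h2 := (isPreserving_left_r 1).mul_preserving hg'
    obtain ⟨c, p, q, hk⟩ := isPreserving_rotation_of_le_hol hn hf hle'
      (mul_mem (hle ⟨r 1, rfl⟩) (hright hg)) (by convert h2 using 1 <;> ring)
    exact rotation_orbits_of_isPreserving hf hreg hk
  · intro h N hN
    obtain ⟨u, s, hu, hs, rfl⟩ := exists_eq_blockGroup_of_mem_classRW (by omega) h
    exact ⟨hblock u s hu hs, le_hol_blockGroup_of_mem (by omega) hN⟩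

/-! ### Counting block groups -/

theorem blockGroup_injective [NeZero n] {u s u' s' : ZMod n} {hu : u * u = 1} {hs : IsTwist s}
    {hu' : u' * u' = 1} {hs' : IsTwist s'}
    (h : blockGroup u s hu hs = blockGroup u' s' hu' hs') : u = u' ∧ s = s' := by
  obtain ⟨g, hg, hg'⟩ := exists_preserving_mem hu hs 1
  rw [h] at hg
  obtain ⟨m, hm⟩ | ⟨m, hm⟩ := hg
  · obtain ⟨h1, rfl, h3⟩ := hg'.unique hm
    exact ⟨by linear_combination h3, by linear_combination h1⟩
  · exact (hm.not_preserving hg').elim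

theorem ncard_classRW [NeZero n] (hn : 2 < n) :
    (classRW (leftReg (DihedralGroup n)) (leftReg (DihedralGroup n)) (X0 n) (Y0 n)).ncard =
      (Upsilon n).ncard * {s : ZMod n | IsTwist s}.ncard := by
  let F : {u : ZMod n // u * u = 1} × {s : ZMod n // IsTwist s} →
      Subgroup (Perm (DihedralGroup n)) := fun x => blockGroup x.1 x.2 x.1.2 x.2.2
  have hF : Function.Injective F := by
    rintro ⟨⟨u, hu⟩, ⟨s, hs⟩⟩ ⟨⟨u', hu'⟩, ⟨s', hs'⟩⟩ h
    obtain ⟨rfl, rfl⟩ := blockGroup_injective h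
    rfl
  have hrange : classRW (leftReg (DihedralGroup n)) (leftReg (DihedralGroup n)) (X0 n) (Y0 n) =
      Set.range F := by
    ext N
    constructor
    · intro hN
      obtain ⟨u, s, hu, hs, rfl⟩ := exists_eq_blockGroup_of_mem_classRW hn hN
      exact ⟨(⟨u, hu⟩, ⟨s, hs⟩), rfl⟩
    · rintro ⟨x, rfl⟩
      exact blockGroup_mem_classRW hn x.1.2 x.2.2
  let e : Upsilon n ≃ {u : ZMod n // u * u = 1} :=
    { toFun := fun u => ⟨u.1, by
        rw [← Units.val_mul, ← pow_two, show (u : (ZMod n)ˣ) ^ 2 = 1 from u.2, Units.val_one]⟩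
      invFun := fun u => ⟨⟨u, u, u.2, u.2⟩, by
        rw [Upsilon, Set.mem_ofPred_eq, pow_two]; exact Units.ext u.2⟩
      left_inv := fun u => Subtype.ext (Units.ext rfl)
      right_inv := fun u => rfl }
  rw [hrange, ← Nat.card_coe_set_eq, Nat.card_range_of_injective hF, Nat.card_prod,
    ← Nat.card_coe_set_eq (Upsilon n), Nat.card_congr e]
  rfl

/-- A nonzero `s` with `2 s = 0` is `n / 2`; `s² = 0` makes it even, say `2 k` with `n = 4 k`; and
`2 + s` dividing `2` forces `k` even. -/
theorem isTwist_iff [NeZero n] {s : ZMod n} :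
    IsTwist s ↔ s = 0 ∨ 8 ∣ n ∧ s = ((n / 2 : ℕ) : ZMod n) := by
  constructor
  · intro hs
    by_cases h0 : s = 0
    · exact Or.inl h0
    right
    have hdvd : ∀ m : ℕ, (m : ZMod n) = 0 → n ∣ m := fun m => (ZMod.natCast_eq_zero_iff m n).mp
    have hcast : ((s.val : ℕ) : ZMod n) = s := ZMod.natCast_zmod_val s
    have hn : n = 2 * s.val := by
      obtain ⟨k, hk⟩ := hdvd (s.val + s.val) (by push_cast; rw [hcast]; exact hs.add_self)
      have h2 : 0 < s.val := ZMod.val_pos.mpr h0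
      have h3 := ZMod.val_lt s
      obtain rfl : k = 1 := by
        rcases k with _ | _ | k
        · omega
        · rfl
        · nlinarith
      omega
    obtain ⟨k, hk⟩ := hdvd (s.val * s.val) (by push_cast; rw [hcast]; exact hs.mul_self)
    have hpos : 0 < s.val := ZMod.val_pos.mpr h0
    have hk2 : s.val = 2 * k := by
      have : n * k = s.val * (2 * k) := by nlinarith
      rw [this] at hk
      exact Nat.eq_of_mul_eq_mul_left hpos hk
    obtain ⟨e, he⟩ := hs.exists_mul_eq_two
    have hdvd' : ((n : ℕ) : ℤ) ∣ (2 + 2 * k) * e.val - 2 := by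
      rw [← ZMod.intCast_zmod_eq_zero_iff_dvd]
      push_cast
      rw [ZMod.natCast_zmod_val]
      have : (2 : ZMod n) * (k : ZMod n) = s := by
        rw [← hcast, hk2]; push_cast; rfl
      linear_combination e * this + he
    have hk' : Even k := by
      by_contra hodd
      rw [Nat.not_even_iff_odd] at hodd
      obtain ⟨j, rfl⟩ := hodd
      obtain ⟨l, hl⟩ := hdvd'
      have hn' : (n : ℤ) = 4 * (2 * j + 1) := by rw [hn, hk2]; push_cast; ring
      rw [hn'] at hl
      push_cast at hl
      -- For odd `k` both `2 + 2 k` and `n` are multiples of `4`, so `2` would be one too.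
      have : (2 : ℤ) = 4 * ((1 + j) * e.val - (2 * j + 1) * l) := by linear_combination -hl
      generalize (1 + j) * (e.val : ℤ) - (2 * j + 1) * l = y at this
      omega
    obtain ⟨j, hj⟩ := hk'
    refine ⟨⟨j, by omega⟩, ?_⟩
    have : n / 2 = s.val := by omega
    rw [this, hcast]
  · rintro (rfl | ⟨⟨v, hv⟩, hs⟩)
    · exact isTwist_zero
    · have h2 : n / 2 = 4 * v := by omega
      rw [h2] at hs
      push_cast at hs
      have h8 : (8 : ZMod n) * v = 0 := by
        have : ((8 * v : ℕ) : ZMod n) = 0 := by rw [← hv]; exact ZMod.natCast_self n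
        exact_mod_cast this
      subst hs
      exact ⟨by linear_combination h8, by linear_combination 2 * v * h8, 1 + 2 * v,
        by linear_combination (1 + v) * h8⟩

theorem ncard_setOf_isTwist [NeZero n] :
    {s : ZMod n | IsTwist s}.ncard = if 8 ∣ n then 2 else 1 := by
  split_ifs with h
  · have hne : (0 : ZMod n) ≠ ((n / 2 : ℕ) : ZMod n) := by
      intro h0
      have h1 := (ZMod.natCast_eq_zero_iff (n / 2) n).mp h0.symm
      have h2 := NeZero.pos n
      have := Nat.le_of_dvd (by omega) h1
      omega
    rw [← Set.ncard_pair hne]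
    congr 1
    ext s
    simp [isTwist_iff, h]
  · rw [← Set.ncard_singleton (0 : ZMod n)]
    congr 1
    ext s
    simp [isTwist_iff, h]

end QuasiHol

theorem mainTheorem6 (n : ℕ) (hn : 4 < n) :
    QuasiHol.calQ (DihedralGroup n) =
        QuasiHol.classRW (QuasiHol.leftReg (DihedralGroup n)) (QuasiHol.leftReg (DihedralGroup n))
          (QuasiHol.X0 n) (QuasiHol.Y0 n) ∧
      (¬ 8 ∣ n →
        (QuasiHol.calQ (DihedralGroup n)).ncard = (QuasiHol.Upsilon n).ncard) ∧
      (8 ∣ n →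
        (QuasiHol.calQ (DihedralGroup n)).ncard = 2 * (QuasiHol.Upsilon n).ncard) := by
  have : NeZero n := ⟨by omega⟩
  have h := QuasiHol.calQ_eq_classRW hn
  refine ⟨h, fun h8 => ?_, fun h8 => ?_⟩
  · rw [h, QuasiHol.ncard_classRW (by omega), QuasiHol.ncard_setOf_isTwist, if_neg h8, mul_one]
  · rw [h, QuasiHol.ncard_classRW (by omega), QuasiHol.ncard_setOf_isTwist, if_pos h8, mul_comm]
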